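/- Fix a commutative semiring $(K,\oplus,\odot,0,1)$ with $0\neq 1$. **Matrix side.** A matrix schema $\mathcal S$ is a finite set of size symbols, containing the symbol $1$, together with a finite set of matrix symbols $\mathbf A$, each with a type $(\alpha,\beta)$, a pair of size symbols of $\mathcal S$. An instance $\mathcal I$ over $\mathcal S$ assigns to each size symbol $\alpha$ a positive integer $\alpha^{\mathcal I}$, with $1^{\mathcal I}=1$, and to each $\mathbf A\colon(\alpha,\beta)$ a $K$-matrix $\mathbf A^{\mathcal I}$ of dimension $\alpha^{\mathcal I}\times\beta^{\mathcal I}$. The expressions of fc-MATLANG are the well-typed expressions of the grammar $$e ::= \mathbf A \mid \mathbf 1^\alpha \mid \mathbf I^\alpha \mid e^T \mid e_1\times e_2 \mid e_1\odot e_2 \mid e_1\cdot e_2,$$ where $\mathbf 1^\alpha\colon(\alpha,1)$ is the all-ones column vector, $\mathbf I^\alpha\colon(\alpha,\alpha)$ the identity matrix, $e_1\times e_2$ is multiplication by a scalar $e_1\colon(1,1)$, $\odot$ is the entrywise product of two matrices of the same type, and the matrix product $e_1\cdot e_2$ (of types $(\alpha,\beta)$ and $(\beta,\gamma)$) is allowed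 only if $e_1$ or $e_2$ has a type of the form $(\delta,1)$ or $(1,\delta)$. An fc-MATLANG query over $\mathcal S$ is $\mathbf H:=e$ with $e$ an fc-MATLANG expression over $\mathcal S$ and $\mathbf H\notin\mathcal S$ a matrix symbol of the type of $e$; its output on $\mathcal I$ is $\mathbf H=[\![e]\!]_{\mathcal I}$. **Relational side.** A vocabulary $\sigma$ is a finite set of relation symbols with arities and of constant symbols, containing the constant symbol $1$. A database over $\sigma$ assigns to each relation symbol $R$ of arity $k$ a function $R^{db}\colon\mathbb N_{>0}^k\to K$ of finite support, and to each constant symbol $c$ a value $c^{db}\in\mathbb N_{>0}$, with $1^{db}=1$. A conjunctive query (CQ) is $Q\colon H(\bar x)\gets\exists\bar y.\,a_1\wedge\dots\wedge a_n$ with $n\ge 1$, where each $a_i$ is a relational atom $R(\bar z)$ or a comparison atom $z\le c$ ($R,c\in\sigma$), $H\notin\sigma$, and the variables of $\bar x$, which may repeat, are exactly the free variables of the body. It is evaluated with semiring semantics: conjunction is $\odot$; $\exists$ is the $\oplus$-sum over the values of the quantified variable (if that variable is not free in the quantified formula, $\exists$ has no effect); $z\le c$ has value $1$ or $0$; and $H$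 is $0$ on tuples that give different values to equal head variables. $Q$ is binary if all relation symbols occurring in it, including $H$, have arity at most $2$. $Q$ is acyclic if there is a tree with node set $\{a_1,\dots,a_n\}$ in which, for each variable $z$, the atoms mentioning $z$ (comparison atoms included) induce a connected subtree; $Q$ is free-connex if both $Q$ and the query obtained by adding the head atom $H(\bar x)$ to its body are acyclic. **Encodings.** A $K$-relation $R$ encodes an $m\times n$ matrix $A$ if $R$ is binary, $R(i,j)=A_{ij}$ for $i\le m$, $j\le n$, and $R(i,j)=0$ otherwise; or if $R$ is unary, $n=1$ (respectively $m=1$), $R(i)=A_{i1}$ (respectively $R(i)=A_{1i}$) in range, and $R(i)=0$ otherwise; or if $R$ is nullary, $m=n=1$ and $R()=A_{11}$. A matrix-to-relational schema encoding $\mathit{Rel}\colon\mathcal S\to\sigma$ is a bijection that maps size symbols to constant symbols, with $1\mapsto 1$, and matrix symbols to relation symbols of arity at most $2$, where unary relation symbols are used only for matrix symbols of vector type $(\alpha,1)$ or $(1,\alpha)$, and nullary ones only for matrix symbols of type $(1,1)$. The inverses of such maps are the relational-to-matrix schema encodings $\mathit{Mat}$. An instance $\mathcal I$ and a database $db$ correspond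 under the encoding if corresponding constants and sizes are equal and every relation encodes the corresponding matrix. A matrix query $\mathbf H:=e$ over $\mathcal S$ and a relational query $Q$ over $\sigma$ with head symbol $H$, where $\mathbf H$ corresponds to $H$ under an encoding between $\mathcal S\cup\{\mathbf H\}$ and $\sigma\cup\{H\}$, simulate each other if for all corresponding $\mathcal I$ and $db$ the relation that $Q$ computes on $db$ encodes the matrix $[\![e]\!]_{\mathcal I}$. A CQ $Q$ is well typed with respect to $\mathit{Mat}$ if there is a map $\tau$ from the variables of $Q$ to size symbols such that: for each atom $R(z_1,z_2)$ the type of $\mathit{Mat}(R)$ is $(\tau(z_1),\tau(z_2))$; for each atom $R(z)$ it is $(\tau(z),1)$ or $(1,\tau(z))$; for each atom $R()$ it is $(1,1)$; for each atom $z\le c$, $\tau(z)=\mathit{Mat}(c)$; and the head atom satisfies the same condition as a relational atom. **Statement.** fc-MATLANG and binary free-connex CQs are equally expressive, that is: 1. For every fc-MATLANG query $\mathbf H:=e$ over a matrix schema $\mathcal S$ and every matrix-to-relational schema encoding $\mathit{Rel}$ on $\mathcal S\cup\{\mathbf H\}$ there is a binary free-connex CQ with head symbol $\mathit{Rel}(\mathbf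 H)$ that simulates it with respect to $\mathit{Rel}$ and is well typed with respect to $\mathit{Rel}^{-1}$. 2. For every binary free-connex CQ $Q$ over a vocabulary $\sigma$ with head symbol $H$ and every relational-to-matrix schema encoding $\mathit{Mat}$ on $\sigma\cup\{H\}$ with respect to which $Q$ is well typed, there is an fc-MATLANG query with output symbol $\mathit{Mat}(H)$ that simulates $Q$ with respect to $\mathit{Mat}$. -/

import Mathlib

universe u v w

/-! ### Matrix schemas, instances, and the language MATLANG -/

/-- A matrix schema: finitely many size symbols, among them the special symbol `1`, and finitely
many matrix symbols, each with a type (a pair of size symbols). -/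
structure MatSchema where
  Size : Type u
  one : Size
  Mat : Type u
  ty : Mat → Size × Size
  finite_size : Finite Size
  finite_mat : Finite Mat

/-- A matrix instance: a positive dimension for every size symbol (with `1 ↦ 1`), and a matrix of
the corresponding dimensions for every matrix symbol. -/
structure MatInstance (K : Type w) (S : MatSchema.{u}) where
  dim : S.Size → ℕ+
  dim_one : dim S.one = 1
  mat : (A : S.Mat) → Matrix (Fin (dim (S.ty A).1)) (Fin (dim (S.ty A).2)) K

/-- Well-typed MATLANG expressions over `S`; `Expr S α β` is the type of the expressions of
type `(α, β)`. A MATLANG query `H := e` with a fresh matrix symbol `H` of type `(α, β)` is given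
by its right-hand side `e : Expr S α β`. -/
inductive Expr (S : MatSchema.{u}) : S.Size → S.Size → Type u
  | sym (A : S.Mat) : Expr S (S.ty A).1 (S.ty A).2
  | transpose {α β : S.Size} (e : Expr S α β) : Expr S β α
  | mul {α β γ : S.Size} (e₁ : Expr S α β) (e₂ : Expr S β γ) : Expr S α γ
  | add {α β : S.Size} (e₁ e₂ : Expr S α β) : Expr S α β
  | smul {α β : S.Size} (e₁ : Expr S S.one S.one) (e₂ : Expr S α β) : Expr S α β
  | hadamard {α β : S.Size} (e₁ e₂ : Expr S α β) : Expr S α β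
  | ones (α : S.Size) : Expr S α S.one
  | ident (α : S.Size) : Expr S α α

/-- The value of an expression of type `(α, β)` on an instance. -/
def Expr.eval {K : Type w} [CommSemiring K] {S : MatSchema.{u}} (I : MatInstance K S) :
    {α β : S.Size} → Expr S α β → Matrix (Fin (I.dim α)) (Fin (I.dim β)) K
  | _, _, .sym A => I.mat A
  | _, _, .transpose e => (e.eval I).transpose
  | _, _, .mul e₁ e₂ => e₁.eval I * e₂.eval I
  | _, _, .add e₁ e₂ => e₁.eval I + e₂.eval I
  | _, _, .smul e₁ e₂ =>
      e₁.eval I ⟨0, (I.dim S.one).pos⟩ ⟨0, (I.dim S.one).pos⟩ • e₂.eval I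
  | _, _, .hadamard e₁ e₂ => Matrix.hadamard (e₁.eval I) (e₂.eval I)
  | _, _, .ones _ => Matrix.of fun _ _ => 1
  | _, _, .ident _ => 1

/-- The types `(α, 1)` and `(1, α)`. -/
def MatSchema.IsVectorType (S : MatSchema.{u}) (t : S.Size × S.Size) : Prop :=
  t.1 = S.one ∨ t.2 = S.one

/-- The fragment fc-MATLANG: no addition, and in every matrix multiplication at least one of the
two operands has a (row or column) vector type. -/
def Expr.IsFC {S : MatSchema.{u}} : {α β : S.Size} → Expr S α β → Prop
  | _, _, .sym _ => True
  | _, _, .transpose e => e.IsFC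
  | _, _, .mul (α := α) (β := β) (γ := γ) e₁ e₂ =>
      e₁.IsFC ∧ e₂.IsFC ∧ (S.IsVectorType (α, β) ∨ S.IsVectorType (β, γ))
  | _, _, .add _ _ => False
  | _, _, .smul e₁ e₂ => e₁.IsFC ∧ e₂.IsFC
  | _, _, .hadamard e₁ e₂ => e₁.IsFC ∧ e₂.IsFC
  | _, _, .ones _ => True
  | _, _, .ident _ => True

/-! ### Vocabularies, databases, and conjunctive queries -/

/-- A vocabulary: finitely many relation symbols with arities, and finitely many constant symbols,
among them the special symbol `1`. -/
structure Vocabulary where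
  Rel : Type v
  arity : Rel → ℕ
  Const : Type v
  one : Const
  finite_rel : Finite Rel
  finite_const : Finite Const

/-- A `K`-relation of arity `k` over the positive natural numbers, of finite support. -/
structure KRelation (K : Type w) [Zero K] (k : ℕ) where
  val : (Fin k → ℕ+) → K
  finite_support : (Function.support val).Finite

/-- A database: a `K`-relation for every relation symbol, a positive natural number for every
constant symbol (with `1 ↦ 1`). -/
structure Database (K : Type w) [Zero K] (σ : Vocabulary.{v}) where
  rel : (R : σ.Rel) → KRelation K (σ.arity R)
  const : σ.Const → ℕ+
  const_one : const σ.one = 1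

/-- Atoms: relational atoms `R(x₁, …, x_k)` and comparison atoms `x ≤ c`. Variables are natural
numbers. -/
inductive Atom (σ : Vocabulary.{v}) : Type v
  | rel (R : σ.Rel) (args : Fin (σ.arity R) → ℕ)
  | le (x : ℕ) (c : σ.Const)

/-- The variables of an atom. -/
def Atom.vars {σ : Vocabulary.{v}} : Atom σ → Finset ℕ
  | .rel _ args => Finset.univ.image args
  | .le x _ => {x}

/-- Conjunctive first-order formulas: atoms, conjunction, existential quantification. -/
inductive Formula (σ : Vocabulary.{v}) : Type v
  | atom (a : Atom σ)
  | and (φ ψ : Formula σ)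
  | ex (y : ℕ) (φ : Formula σ)

/-- The free variables of a formula. -/
def Formula.free {σ : Vocabulary.{v}} : Formula σ → Finset ℕ
  | .atom a => a.vars
  | .and φ ψ => φ.free ∪ ψ.free
  | .ex y φ => φ.free.erase y

/-- The multiset of atoms of a formula. -/
def Formula.atoms {σ : Vocabulary.{v}} : Formula σ → Multiset (Atom σ)
  | .atom a => {a}
  | .and φ ψ => φ.atoms + ψ.atoms
  | .ex _ φ => φ.atoms

/-- Semiring semantics of atoms. -/
def Atom.eval {K : Type w} [CommSemiring K] {σ : Vocabulary.{v}} (db : Database K σ)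
    (ν : ℕ → ℕ+) : Atom σ → K
  | .rel R args => (db.rel R).val fun i => ν (args i)
  | .le x c => if ν x ≤ db.const c then 1 else 0

/-- Semiring semantics of formulas. Only the values of the valuation `ν` on the free variables
matter. `∃ y, φ` is the sum of the values of `φ` over the valuations of the free variables of `φ`
that agree with `ν` off `y`; if `y` is not free in `φ` there is exactly one of them. The sum has
finitely many nonzero terms. -/
noncomputable def Formula.eval {K : Type w} [CommSemiring K] {σ : Vocabulary.{v}}
    (db : Database K σ) : Formula σ → (ℕ → ℕ+) → K
  | .atom a, ν => a.eval db ν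
  | .and φ ψ, ν => φ.eval db ν * ψ.eval db ν
  | .ex y φ, ν =>
      if y ∈ φ.free then ∑ᶠ d : ℕ+, φ.eval db (Function.update ν y d) else φ.eval db ν

/-- A query `H(x₁, …, x_k) ← φ` over `σ`, with `H` a fresh relation symbol of arity `k`. The head
variables may repeat, and they are exactly the free variables of `φ`. -/
structure Query (σ : Vocabulary.{v}) (k : ℕ) where
  head : Fin k → ℕ
  body : Formula σ
  free_body : body.free = Finset.univ.image head

open Classical in
/-- The `K`-relation that a query assigns to its head symbol: the tuple `d` is mapped to the value
of the body under the valuation `xᵢ ↦ dᵢ` if this is well defined, and to `0` otherwise. -/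
noncomputable def Query.eval {K : Type w} [CommSemiring K] {σ : Vocabulary.{v}} {k : ℕ}
    (Q : Query σ k) (db : Database K σ) (d : Fin k → ℕ+) : K :=
  if ∀ i j, Q.head i = Q.head j → d i = d j then
    Q.body.eval db (Function.extend Q.head d fun _ => 1)
  else 0

/-- A conjunction `a₁ ∧ ⋯ ∧ aₙ` of atoms, `n ≥ 1`. -/
def Formula.IsAtomConj {σ : Vocabulary.{v}} : Formula σ → Prop
  | .atom _ => True
  | .and φ ψ => φ.IsAtomConj ∧ ψ.IsAtomConj
  | .ex _ _ => False

/-- A formula in prenex normal form `∃ y₁ ⋯ ∃ yₘ, a₁ ∧ ⋯ ∧ aₙ`. -/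
def Formula.IsPrenex {σ : Vocabulary.{v}} : Formula σ → Prop
  | .atom _ => True
  | .and φ ψ => φ.IsAtomConj ∧ ψ.IsAtomConj
  | .ex _ φ => φ.IsPrenex

/-- Conjunctive queries. -/
def Query.IsCQ {σ : Vocabulary.{v}} {k : ℕ} (Q : Query σ k) : Prop :=
  Q.body.IsPrenex

/-- Binary queries: every relational atom, in the body or in the head, has arity at most two. -/
def Query.IsBinary {σ : Vocabulary.{v}} {k : ℕ} (Q : Query σ k) : Prop :=
  k ≤ 2 ∧ ∀ (R : σ.Rel) (args : Fin (σ.arity R) → ℕ),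
    Atom.rel R args ∈ Q.body.atoms → σ.arity R ≤ 2

/-- Existence of a join tree: a tree on the nodes such that, for every variable `z`, the nodes that
mention `z` induce a connected subtree (no condition if no node mentions `z`). -/
def HasJoinTree {V : Type v} (vars : V → Finset ℕ) : Prop :=
  ∃ T : SimpleGraph V, T.IsTree ∧ ∀ z : ℕ, (T.induce {a | z ∈ vars a}).Preconnected

/-- The variables of the atoms of the body. -/
def Query.atomVars {σ : Vocabulary.{v}} {k : ℕ} (Q : Query σ k)
    (a : {a : Atom σ // a ∈ Q.body.atoms}) : Finset ℕ :=
  a.1.vars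

/-- The same with the head atom as an additional node, `none`. As the head symbol is fresh, the
head atom is different from all the atoms of the body. -/
def Query.atomVarsWithHead {σ : Vocabulary.{v}} {k : ℕ} (Q : Query σ k) :
    Option {a : Atom σ // a ∈ Q.body.atoms} → Finset ℕ
  | none => Finset.univ.image Q.head
  | some a => Q.atomVars a

/-- A free-connex query: it is acyclic, and so is the query with the head atom added to the
body. -/
def Query.IsFreeConnex {σ : Vocabulary.{v}} {k : ℕ} (Q : Query σ k) : Prop :=
  HasJoinTree Q.atomVars ∧ HasJoinTree Q.atomVarsWithHead

/-! ### Encodings between matrices and relations -/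

/-- A matrix symbol of type `t` may be encoded by a relation symbol of arity `k`: always if `k` is
`2`, only if `t` is a vector type if `k` is `1`, only if `t` is the scalar type if `k` is `0`. -/
def MatSchema.Encodable (S : MatSchema.{u}) (t : S.Size × S.Size) (k : ℕ) : Prop :=
  k = 2 ∨ (k = 1 ∧ S.IsVectorType t) ∨ (k = 0 ∧ t = (S.one, S.one))

/-- A schema encoding: a bijection between the symbols of a matrix schema and those of a
vocabulary, read as a matrix-to-relational encoding from left to right, and as a
relational-to-matrix encoding from right to left. -/
structure SchemaEncoding (S : MatSchema.{u}) (σ : Vocabulary.{v}) where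
  size : S.Size ≃ σ.Const
  size_one : size S.one = σ.one
  mat : S.Mat ≃ σ.Rel
  encodable : ∀ A, S.Encodable (S.ty A) (σ.arity (mat A))

/-- `R ≃ A`: the `k`-ary relation `R` encodes the `m × n` matrix `A`. The matrix index `i : Fin m`
stands for the data value `i + 1`. -/
def EncodesMatrix {K : Type w} [Zero K] {m n : ℕ} (A : Matrix (Fin m) (Fin n) K) :
    (k : ℕ) → ((Fin k → ℕ+) → K) → Prop
  | 0, R => m = 1 ∧ n = 1 ∧ ∀ i j, R ![] = A i j
  | 1, R =>
      (n = 1 ∧ (∀ (i : Fin m) (j : Fin n), R ![Nat.succPNat i] = A i j) ∧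
        ∀ d : ℕ+, m < (d : ℕ) → R ![d] = 0) ∨
      (m = 1 ∧ (∀ (i : Fin m) (j : Fin n), R ![Nat.succPNat j] = A i j) ∧
        ∀ d : ℕ+, n < (d : ℕ) → R ![d] = 0)
  | 2, R =>
      (∀ (i : Fin m) (j : Fin n), R ![Nat.succPNat i, Nat.succPNat j] = A i j) ∧
        ∀ d d' : ℕ+, m < (d : ℕ) ∨ n < (d' : ℕ) → R ![d, d'] = 0
  | _ + 3, _ => False

/-- `db` is the relational encoding of `I`; equivalently, `db` is consistent with the
relational-to-matrix encoding and `I` is its matrix encoding. -/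
def SchemaEncoding.Encodes {K : Type w} [Zero K] {S : MatSchema.{u}} {σ : Vocabulary.{v}}
    (E : SchemaEncoding S σ) (I : MatInstance K S) (db : Database K σ) : Prop :=
  (∀ A, EncodesMatrix (I.mat A) (σ.arity (E.mat A)) (db.rel (E.mat A)).val) ∧
    ∀ α, db.const (E.size α) = I.dim α

/-- The query `H := e`, whose output symbol is matched with the head symbol of `Q`, and the query
`Q` simulate each other: on corresponding inputs they give corresponding outputs. -/
def SchemaEncoding.Simulates (K : Type w) [CommSemiring K] {S : MatSchema.{u}}
    {σ : Vocabulary.{v}} (E : SchemaEncoding S σ) {α β : S.Size} {k : ℕ}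
    (e : Expr S α β) (Q : Query σ k) : Prop :=
  ∀ (I : MatInstance K S) (db : Database K σ), E.Encodes I db →
    EncodesMatrix (e.eval I) k (Q.eval db)

/-! ### Well-typed queries -/

/-- A relation symbol that encodes a matrix symbol of type `t` takes arguments of the sizes `s`. -/
def MatSchema.ArgsTyped (S : MatSchema.{u}) (t : S.Size × S.Size) :
    (k : ℕ) → (Fin k → S.Size) → Prop
  | 0, _ => t = (S.one, S.one)
  | 1, s => t = (s 0, S.one) ∨ t = (S.one, s 0)
  | 2, s => t = (s 0, s 1)
  | _ + 3, _ => False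

/-- The typing relation for atoms, where `τ` maps variables to size symbols. -/
def SchemaEncoding.AtomTyped {S : MatSchema.{u}} {σ : Vocabulary.{v}} (E : SchemaEncoding S σ)
    (τ : ℕ → S.Size) : Atom σ → Prop
  | .rel R args => S.ArgsTyped (S.ty (E.mat.symm R)) (σ.arity R) fun i => τ (args i)
  | .le x c => τ x = E.size.symm c

/-- The typing relation for formulas; only the values of `τ` on the free variables matter. -/
def SchemaEncoding.Typed {S : MatSchema.{u}} {σ : Vocabulary.{v}} (E : SchemaEncoding S σ) :
    Formula σ → (ℕ → S.Size) → Prop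
  | .atom a, τ => E.AtomTyped τ a
  | .and φ ψ, τ => E.Typed φ τ ∧ E.Typed ψ τ
  | .ex y φ, τ => ∃ α, E.Typed φ (Function.update τ y α)

/-- A query is well typed when its head symbol encodes a matrix symbol of type `t`. -/
def SchemaEncoding.QueryTyped {S : MatSchema.{u}} {σ : Vocabulary.{v}} (E : SchemaEncoding S σ)
    (t : S.Size × S.Size) {k : ℕ} (Q : Query σ k) : Prop :=
  ∃ τ : ℕ → S.Size, E.Typed Q.body τ ∧ S.ArgsTyped t k fun i => τ (Q.head i)

/-! ### Equal expressiveness -/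

/-- A matrix query language `LM` and a relational query language `LR` are equally expressive over
the semiring `K`. An encoding of the schema `S ∪ {H}` of a matrix query (of the vocabulary
`σ ∪ {H}` of a relational query) consists of an encoding `E` between `S` and `σ` and, for the
output symbol, of its arity `k` (its type `(α, β)`), subject to encodability. -/
def EquallyExpressive (K : Type w) [CommSemiring K]
    (LM : ∀ ⦃S : MatSchema.{u}⦄ ⦃α β : S.Size⦄, Expr S α β → Prop)
    (LR : ∀ ⦃σ : Vocabulary.{v}⦄ ⦃k : ℕ⦄, Query σ k → Prop) : Prop :=
  (∀ (S : MatSchema.{u}) (σ : Vocabulary.{v}) (E : SchemaEncoding S σ) (α β : S.Size)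
      (e : Expr S α β) (k : ℕ), LM e → S.Encodable (α, β) k →
      ∃ Q : Query σ k, LR Q ∧ E.QueryTyped (α, β) Q ∧ E.Simulates K e Q) ∧
  (∀ (S : MatSchema.{u}) (σ : Vocabulary.{v}) (E : SchemaEncoding S σ) (k : ℕ)
      (Q : Query σ k) (α β : S.Size), LR Q → Q.IsBinary → S.Encodable (α, β) k →
      E.QueryTyped (α, β) Q →
      ∃ e : Expr S α β, LM e ∧ E.Simulates K e Q)

/-!
Both languages compute the same functions of at most two variables, when a matrix of type `(α, β)`
is read as the function `Matrix.zeroExt` of two data values that vanishes out of range.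

Join trees are handled as running-intersection orders (`JoinSet`): the nodes are listed from a root
on, and the variables that a new node shares with the earlier ones are all contained in its parent.
`HasJoinTree.joinSet` and `JoinSet.hasJoinTree` translate between the two notions. What makes the
orders convenient is `JoinSet.transfer`, which replaces the root by another join tree.

From queries to expressions (`exists_expr_of_query`), the join tree of the query extended by the
head atom is rooted at the head atom and evaluated from the leaves, as in Yannakakis' algorithm
(`IsMatlang.joinSet`). A leaf has at most two variables, so its value is a scalar, a vector or a
matrix. Summing it over the variables that it does not share with its parent is a product with an
all-ones vector, and multiplying the result into the parent is a scalar multiplication or an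
entrywise product, possibly with a matrix of equal rows or columns. All of these are fc-MATLANG
operations.

From expressions to queries (`exists_query_of_expr`), induction on the expression produces, for
fresh bound variables, a conjunction of atoms with a join tree rooted at the head atom
(`IsMatrixQuery.of_isFC`). A scalar or entrywise product joins two such trees at the head atom
(`QueryTree.mul`). In a matrix product one of the three sizes involved is `1`; as a variable of
type `1` has only one value, it need not be shared by the two factors, and what remains is an outer
product of vectors or a matrix-vector product, in which one head variable is quantified
(`QueryTree.sumVar`). That last step relies on `QueryTree.headless`: as all atoms have at most two
variables, the head atom can be removed from a join tree and a smaller head attached to the result.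
An identity matrix would need an equality between its two head variables, so the induction keeps
track of the expressions that denote diagonal matrices, and queries for these repeat the head
variable.
-/

/-! ### Running-intersection orders and join trees -/

/-- `JoinSet vars r s`: the nodes `s` can be listed, starting with `r`, so that every later node `a`
has an earlier parent `p` that contains each variable shared by `a` and some earlier node. Such an
order is a join tree on `s` rooted at `r`, presented leaf by leaf. -/
inductive JoinSet {V : Type*} [DecidableEq V] (vars : V → Finset ℕ) (r : V) : Finset V → Prop
  | root : JoinSet vars r {r}
  | insert {s : Finset V} {a p : V} (h : JoinSet vars r s) (hp : p ∈ s)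
      (hap : ∀ z ∈ vars a, (∃ b ∈ s, z ∈ vars b) → z ∈ vars p) : JoinSet vars r (insert a s)

namespace JoinSet

variable {V W : Type*} [DecidableEq V] [DecidableEq W]

lemma root_mem {vars : V → Finset ℕ} {r : V} {s : Finset V} (h : JoinSet vars r s) : r ∈ s := by
  induction h with
  | root => simp
  | insert _ _ _ ih => exact Finset.mem_insert_of_mem ih

/-- Replacing the root of a join tree by another join tree. The base `t` must not add
connections to the other nodes, and has to offer a parent to every node that hung below the old
root. -/
lemma transfer {vars vars' : V → Finset ℕ} {r r' : V} {s t : Finset V} (h : JoinSet vars r s)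
    (ht : JoinSet vars' r' t) (hvars : ∀ a ∈ s, a ≠ r → vars' a = vars a)
    (hsep : ∀ a ∈ s, a ≠ r → ∀ z ∈ vars a, (∃ b ∈ t, z ∈ vars' b) → z ∈ vars r)
    (hparent : ∀ a ∈ s, a ≠ r → ∃ p ∈ t, ∀ z ∈ vars a, z ∈ vars r → z ∈ vars' p) :
    JoinSet vars' r' (t ∪ s.erase r) := by
  induction h with
  | root => simpa using ht
  | @insert s a p h hp hap ih =>
    have ih := ih (fun b hb => hvars b (Finset.mem_insert_of_mem hb))
      (fun b hb => hsep b (Finset.mem_insert_of_mem hb))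
      (fun b hb => hparent b (Finset.mem_insert_of_mem hb))
    by_cases har : a = r
    · rw [har, Finset.insert_eq_of_mem h.root_mem]; exact ih
    have ha := Finset.mem_insert_self a s
    rw [Finset.erase_insert_of_ne har, Finset.union_insert]
    -- the variables seen so far are those seen in `s`, up to variables that do not occur in `a`
    have seen : ∀ z ∈ vars' a, (∃ b ∈ t ∪ s.erase r, z ∈ vars' b) → ∃ b ∈ s, z ∈ vars b := by
      rintro z hz ⟨b, hb, hzb⟩
      rw [hvars a ha har] at hz
      rcases Finset.mem_union.1 hb with hb | hb
      · exact ⟨r, h.root_mem, hsep a ha har z hz ⟨b, hb, hzb⟩⟩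
      · obtain ⟨hbr, hbs⟩ := Finset.mem_erase.1 hb
        exact ⟨b, hbs, by rwa [hvars b (Finset.mem_insert_of_mem hbs) hbr] at hzb⟩
    by_cases hpr : p = r
    · obtain ⟨q, hq, hqa⟩ := hparent a ha har
      refine ih.insert (Finset.mem_union_left _ hq) fun z hz hb => ?_
      have hs := seen z hz hb
      rw [hvars a ha har] at hz
      exact hqa z hz (hpr ▸ hap z hz hs)
    · refine ih.insert (Finset.mem_union_right _ (Finset.mem_erase.2 ⟨hpr, hp⟩)) fun z hz hb => ?_
      have hs := seen z hz hb
      rw [hvars a ha har] at hz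
      rw [hvars p (Finset.mem_insert_of_mem hp) hpr]
      exact hap z hz hs

/-- A join tree can be rooted at any of its nodes. -/
lemma reroot {vars : V → Finset ℕ} {r r' : V} {s : Finset V} (h : JoinSet vars r s)
    (hr : r' ∈ s) : JoinSet vars r' s := by
  induction h generalizing r' with
  | root => rw [Finset.mem_singleton.1 hr]; exact .root
  | @insert s a p h hp hap ih =>
    by_cases hr' : r' ∈ s
    · exact (ih hr').insert hp hap
    obtain rfl : r' = a := (Finset.mem_insert.1 hr).resolve_right hr'
    have base : JoinSet vars r' {p, r'} :=
      JoinSet.root.insert (p := r') (by simp) (by simp)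
    have := (ih hp).transfer base (fun _ _ _ => rfl)
      (fun b hb _ z hz => by
        rintro ⟨c, hc, hzc⟩
        rcases Finset.mem_insert.1 hc with rfl | hc
        · exact hzc
        · rw [Finset.mem_singleton.1 hc] at hzc
          exact hap z hzc ⟨b, hb, hz⟩)
      (fun b hb _ => ⟨p, by simp, fun _ _ hz => hz⟩)
    convert this using 1
    ext x
    simp only [Finset.mem_insert, Finset.mem_union, Finset.mem_singleton, Finset.mem_erase]
    grind

end JoinSet

lemma preconnected_induce_insert {V : Type*} {G : SimpleGraph V} {t : Set V} {p a : V}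
    (h : (G.induce t).Preconnected) (hp : p ∈ t) (ha : a ∉ t) :
    ((G ⊔ SimpleGraph.edge p a).induce (insert a t)).Preconnected := by
  have key : ∀ x : (insert a t : Set V),
      ((G ⊔ SimpleGraph.edge p a).induce (insert a t)).Reachable ⟨p, Or.inr hp⟩ x := by
    rintro ⟨x, hx⟩
    by_cases hxt : x ∈ t
    · let hom : G.induce t →g (G ⊔ SimpleGraph.edge p a).induce (insert a t) :=
        { toFun := fun y => ⟨y.1, Or.inr y.2⟩
          map_rel' := fun {u v} huv => Or.inl huv }
      exact (h ⟨p, hp⟩ ⟨x, hxt⟩).map hom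
    · obtain rfl : x = a := hx.resolve_right hxt
      refine SimpleGraph.Adj.reachable (Or.inr ?_)
      rw [SimpleGraph.edge_adj]
      refine ⟨Or.inl ⟨rfl, rfl⟩, fun h => ha ?_⟩
      change p = x at h
      exact h ▸ hp
  exact fun x y => (key x).symm.trans (key y)

lemma preconnected_induce_comap {V W : Type*} {G : SimpleGraph V} {f : W → V} {t : Set V}
    {t' : Set W} (h : (G.induce t).Preconnected) (hf : f.Injective) (htt : t = f '' t') :
    ((G.comap f).induce t').Preconnected := by
  subst htt
  choose g hg hfg using fun x : f '' t' => x.2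
  let hom : G.induce (f '' t') →g (G.comap f).induce t' :=
    { toFun := fun y => ⟨g y, hg y⟩
      map_rel' := fun {u v} huv => by
        change G.Adj (f (g u)) (f (g v))
        rw [hfg, hfg]; exact huv }
  intro x y
  have := (h ⟨f x, x, x.2, rfl⟩ ⟨f y, y, y.2, rfl⟩).map hom
  have e : ∀ x : t', hom ⟨f x, x, x.2, rfl⟩ = x := fun x =>
    Subtype.ext (hf (hfg ⟨f x, x, x.2, rfl⟩))
  rwa [e, e] at this

/-- The edges between the nodes and their parents form a tree on `s`, given here as a graph on all
of `V` without edges outside of `s`. -/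
lemma JoinSet.exists_graph {V : Type*} [DecidableEq V] {vars : V → Finset ℕ} {r : V}
    {s : Finset V} (h : JoinSet vars r s) :
    ∃ G : SimpleGraph V, G.IsAcyclic ∧ (∀ a b, G.Adj a b → b ∈ s) ∧
      (G.induce (s : Set V)).Preconnected ∧
      ∀ z, (G.induce {a | a ∈ s ∧ z ∈ vars a}).Preconnected := by
  have mono : ∀ {G G' : SimpleGraph V} {t : Set V}, G ≤ G' → (G.induce t).Preconnected →
      (G'.induce t).Preconnected := fun hle h => h.mono fun _ _ hab => hle hab
  have sub : ∀ {G : SimpleGraph V} {t : Set V}, t.Subsingleton → (G.induce t).Preconnected :=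
    fun ht x y => by rw [Subtype.ext (ht x.2 y.2)]
  induction h with
  | root =>
    refine ⟨⊥, SimpleGraph.isAcyclic_bot, by simp, sub (by simp), fun z => sub ?_⟩
    intro x hx y hy
    rw [Finset.mem_singleton.1 hx.1, Finset.mem_singleton.1 hy.1]
  | @insert s a p h hp hap ih =>
    by_cases ha : a ∈ s
    · rwa [Finset.insert_eq_of_mem ha]
    obtain ⟨G, hG, hs, hc, hz⟩ := ih
    have hpa : ¬ G.Reachable p a := by
      rintro ⟨w⟩
      have hne : p ≠ a := fun h => ha (h ▸ hp)
      have := w.adj_penultimate (SimpleGraph.Walk.not_nil_of_ne hne)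
      exact ha (hs _ _ this)
    refine ⟨G ⊔ SimpleGraph.edge p a, hG.sup_edge_of_not_reachable hpa, ?_, ?_, fun z => ?_⟩
    · rintro x y (hxy | hxy)
      · exact Finset.mem_insert_of_mem (hs _ _ hxy)
      · rw [SimpleGraph.edge_adj] at hxy
        rcases hxy with ⟨⟨_, rfl⟩ | ⟨_, rfl⟩, _⟩ <;> simp [hp]
    · rw [Finset.coe_insert]
      exact preconnected_induce_insert hc hp ha
    · by_cases hza : z ∈ vars a
      · by_cases hb : ∃ b ∈ s, z ∈ vars b
        · have := preconnected_induce_insert (hz z) ⟨hp, hap z hza hb⟩ (fun h => ha h.1)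
          convert! this using 2
          all_goals
            ext x
            simp only [Set.mem_ofPred_eq, Finset.mem_insert, Set.mem_insert_iff]
            grind
        · refine sub ?_
          rintro x ⟨hx, hzx⟩ y ⟨hy, hzy⟩
          have : ∀ x ∈ Insert.insert a s, z ∈ vars x → x = a := fun x hx hzx =>
            (Finset.mem_insert.1 hx).resolve_right fun h => hb ⟨x, h, hzx⟩
          rw [this x hx hzx, this y hy hzy]
      · have := mono (G' := G ⊔ SimpleGraph.edge p a) le_sup_left (hz z)
        convert! this using 2
        all_goals
          ext x
          simp only [Set.mem_ofPred_eq, Finset.mem_insert]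
          grind

/-- A running-intersection order gives a join tree on every copy of its set of nodes. -/
lemma JoinSet.hasJoinTree {V : Type*} {W : Type v} [DecidableEq V] {vars : V → Finset ℕ} {r : V}
    {s : Finset V} (h : JoinSet vars r s) {f : W → V} (hf : f.Injective)
    (hs : ∀ a, a ∈ s ↔ ∃ b, f b = a) {vars' : W → Finset ℕ} (hvars : ∀ b, vars' b = vars (f b)) :
    HasJoinTree vars' := by
  obtain ⟨G, hG, -, hc, hz⟩ := h.exists_graph
  refine ⟨G.comap f, ⟨?_, ?_⟩, fun z => ?_⟩
  · obtain ⟨b, -⟩ := (hs r).1 h.root_mem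
    have : Nonempty W := ⟨b⟩
    refine ⟨fun x y => ?_⟩
    have := preconnected_induce_comap (t' := Set.univ) hc hf (by ext a; simp [hs])
    exact (this ⟨x, trivial⟩ ⟨y, trivial⟩).map (SimpleGraph.Embedding.induce _).toHom
  · exact hG.comap (SimpleGraph.Hom.comap f G) hf
  · refine preconnected_induce_comap (hz z) hf ?_
    ext a
    simp only [Set.mem_ofPred_eq, Set.mem_image, hs, hvars]
    constructor
    · rintro ⟨⟨b, rfl⟩, h⟩; exact ⟨b, h, rfl⟩
    · rintro ⟨b, h, rfl⟩; exact ⟨⟨b, rfl⟩, h⟩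

/-- A join tree on finitely many nodes gives a running-intersection order from any root: a connected
set of nodes is extended along an edge of the tree, and the path that witnesses the connectedness of
the nodes mentioning a shared variable has to use this edge. -/
lemma HasJoinTree.joinSet {V : Type v} [Fintype V] [DecidableEq V] {vars : V → Finset ℕ}
    (h : HasJoinTree vars) (r : V) : JoinSet vars r Finset.univ := by
  obtain ⟨T, hT, hz⟩ := h
  have grow : ∀ n, ∀ s : Finset V, JoinSet vars r s →
      (∀ x ∈ s, ∀ y ∈ s, ∃ w : T.Walk x y, ∀ v ∈ w.support, v ∈ s) → sᶜ.card = n →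
      JoinSet vars r Finset.univ := by
    intro n
    induction n with
    | zero =>
      intro s hs _ hn
      rw [Finset.card_eq_zero, Finset.compl_eq_empty_iff] at hn
      subst hn
      exact hs
    | succ n ih =>
      intro s hs hconn hn
      obtain ⟨a₀, ha₀⟩ : sᶜ.Nonempty := Finset.card_pos.1 (by omega)
      obtain ⟨w⟩ := hT.connected.preconnected r a₀
      obtain ⟨d, -, hd1, hd2⟩ := w.exists_boundary_dart (s : Set V) hs.root_mem
        (by simpa using ha₀)
      obtain ⟨⟨p, a⟩, hadj⟩ := d
      simp only [Finset.mem_coe] at hd1 hd2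
      change p ∈ s at hd1
      change a ∉ s at hd2
      change T.Adj p a at hadj
      refine ih (insert a s) (hs.insert hd1 ?_) ?_ ?_
      · rintro z hza ⟨b, hb, hzb⟩
        obtain ⟨q, hq⟩ := hconn b hb p hd1
        have hqs : ∀ v ∈ q.bypass.support, v ∈ s := fun v hv =>
          hq v (q.support_bypass_subset_support hv)
        have hpath : (q.bypass.concat hadj).IsPath :=
          q.bypass_isPath.concat (fun h => hd2 (hqs _ h)) hadj
        obtain ⟨q'⟩ := hz z ⟨b, hzb⟩ ⟨a, hza⟩
        have hmap : ∀ v ∈ (q'.map (SimpleGraph.Embedding.induce _).toHom).support, z ∈ vars v := by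
          intro v hv
          rw [SimpleGraph.Walk.support_map, List.mem_map] at hv
          obtain ⟨v', -, rfl⟩ := hv
          exact v'.2
        obtain ⟨q'', hq''⟩ : ∃ q'' : T.Walk b a, ∀ v ∈ q''.support, z ∈ vars v := ⟨_, hmap⟩
        have heq := (hT.isAcyclic.subsingleton_path b a).elim ⟨_, hpath⟩
          ⟨q''.bypass, q''.bypass_isPath⟩
        have heq : q.bypass.concat hadj = q''.bypass := congrArg Subtype.val heq
        refine hq'' p (q''.support_bypass_subset_support ?_)
        rw [← heq, SimpleGraph.Walk.support_concat]
        simp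
      · have toP : ∀ x ∈ insert a s, ∃ w : T.Walk x p, ∀ v ∈ w.support, v ∈ insert a s := by
          intro x hx
          rcases Finset.mem_insert.1 hx with rfl | hx
          · refine ⟨hadj.symm.toWalk, ?_⟩
            simp [hd1]
          · obtain ⟨w, hw⟩ := hconn x hx p hd1
            exact ⟨w, fun v hv => Finset.mem_insert_of_mem (hw v hv)⟩
        intro x hx y hy
        obtain ⟨w, hw⟩ := toP x hx
        obtain ⟨w', hw'⟩ := toP y hy
        refine ⟨w.append w'.reverse, fun v hv => ?_⟩
        rw [SimpleGraph.Walk.mem_support_append_iff] at hv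
        rcases hv with hv | hv
        · exact hw v hv
        · exact hw' v (by simpa using hv)
      · rw [Finset.compl_insert, Finset.card_erase_of_mem (by simpa using hd2), hn]
        rfl
  refine grow _ {r} .root ?_ rfl
  intro x hx y hy
  rw [Finset.mem_singleton] at hx hy
  subst hx hy
  exact ⟨.nil, by simp⟩

/-! ### Matrices as functions of finite support on pairs of positive integers -/

/-- The extension of a matrix by zero to all pairs of data values; the matrix index `i` stands for
the data value `i + 1`. -/
def Matrix.zeroExt {K : Type w} [Zero K] {m n : ℕ} (M : Matrix (Fin m) (Fin n) K) (i j : ℕ+) : K :=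
  if h : (i : ℕ) ≤ m ∧ (j : ℕ) ≤ n then
    M ⟨i.natPred, by have := i.natPred_add_one; omega⟩
      ⟨j.natPred, by have := j.natPred_add_one; omega⟩
  else 0

lemma PNat.exists_fin_of_le {n : ℕ} {i : ℕ+} (h : (i : ℕ) ≤ n) :
    ∃ a : Fin n, Nat.succPNat a = i :=
  ⟨⟨i.natPred, by have := i.natPred_add_one; omega⟩, PNat.succPNat_natPred i⟩

namespace Matrix

variable {K : Type w}

section Zero
variable [Zero K] {m n : ℕ}

lemma zeroExt_eq_zero (M : Matrix (Fin m) (Fin n) K) {i j : ℕ+}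
    (h : m < (i : ℕ) ∨ n < (j : ℕ)) : M.zeroExt i j = 0 :=
  dif_neg (by omega)

@[simp]
lemma zeroExt_succPNat (M : Matrix (Fin m) (Fin n) K) (a : Fin m) (b : Fin n) :
    M.zeroExt (Nat.succPNat a) (Nat.succPNat b) = M a b := by
  rw [zeroExt, dif_pos ⟨by simp, by simp⟩]
  simp

/-- A property of the values of `M.zeroExt` is checked in range and out of range. -/
lemma zeroExt_cases (m n : ℕ) {p : ℕ+ → ℕ+ → Prop} (i j : ℕ+)
    (hin : ∀ (a : Fin m) (b : Fin n), p (Nat.succPNat a) (Nat.succPNat b))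
    (hout : ∀ i j : ℕ+, m < (i : ℕ) ∨ n < (j : ℕ) → p i j) : p i j := by
  by_cases h : (i : ℕ) ≤ m ∧ (j : ℕ) ≤ n
  · obtain ⟨a, rfl⟩ := PNat.exists_fin_of_le h.1
    obtain ⟨b, rfl⟩ := PNat.exists_fin_of_le h.2
    exact hin a b
  · exact hout i j (by omega)

@[simp]
lemma zeroExt_transpose (M : Matrix (Fin m) (Fin n) K) (i j : ℕ+) :
    Mᵀ.zeroExt i j = M.zeroExt j i := by
  induction i, j using zeroExt_cases n m with
  | hin a b => simp
  | hout i j h => rw [zeroExt_eq_zero _ h, zeroExt_eq_zero _ h.symm]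

end Zero

variable [CommSemiring K] {m n : ℕ}

lemma zeroExt_hadamard (M N : Matrix (Fin m) (Fin n) K) (i j : ℕ+) :
    (M.hadamard N).zeroExt i j = M.zeroExt i j * N.zeroExt i j := by
  induction i, j using zeroExt_cases m n with
  | hin a b => simp
  | hout i j h => simp [zeroExt_eq_zero _ h]

lemma zeroExt_smul (c : K) (M : Matrix (Fin m) (Fin n) K) (i j : ℕ+) :
    (c • M).zeroExt i j = c * M.zeroExt i j := by
  induction i, j using zeroExt_cases m n with
  | hin a b => simp
  | hout i j h => simp [zeroExt_eq_zero _ h]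

lemma sum_fin_eq_sum_Icc (N : ℕ+) (f : ℕ+ → K) :
    ∑ a : Fin N, f (Nat.succPNat a) = ∑ d ∈ Finset.Icc 1 N, f d := by
  refine Finset.sum_bij (fun a _ => Nat.succPNat a) ?_ ?_ ?_ (fun _ _ => rfl)
  · intro a _
    rw [Finset.mem_Icc]
    refine ⟨one_le, ?_⟩
    rw [← PNat.coe_le_coe]
    simp
  · intro a _ b _ h
    exact Fin.ext (Nat.succPNat_injective h)
  · intro d hd
    obtain ⟨a, ha⟩ := PNat.exists_fin_of_le (PNat.coe_le_coe _ _ |>.2 (Finset.mem_Icc.1 hd).2)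
    exact ⟨a, Finset.mem_univ _, ha⟩

lemma zeroExt_mul {l : ℕ+} (M : Matrix (Fin m) (Fin l) K) (N : Matrix (Fin l) (Fin n) K)
    (i j : ℕ+) :
    (M * N).zeroExt i j = ∑ d ∈ Finset.Icc 1 l, M.zeroExt i d * N.zeroExt d j := by
  rw [← sum_fin_eq_sum_Icc]
  induction i, j using zeroExt_cases m n with
  | hin a b => simp [Matrix.mul_apply]
  | hout i j h =>
    rw [zeroExt_eq_zero _ h]
    refine (Finset.sum_eq_zero fun d _ => ?_).symm
    rcases h with h | h
    · rw [zeroExt_eq_zero M (Or.inl h), zero_mul]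
    · rw [zeroExt_eq_zero N (Or.inr h), mul_zero]

lemma zeroExt_one (i j : ℕ+) :
    (1 : Matrix (Fin m) (Fin m) K).zeroExt i j = if i = j ∧ (i : ℕ) ≤ m then 1 else 0 := by
  induction i, j using zeroExt_cases m m with
  | hin a b =>
    rw [zeroExt_succPNat, Matrix.one_apply]
    congr 1
    simp [Nat.succPNat_inj, Fin.ext_iff]
  | hout i j h =>
    rw [zeroExt_eq_zero _ h, if_neg]
    rintro ⟨rfl, h'⟩
    omega

lemma zeroExt_ones (i j : ℕ+) :
    (Matrix.of fun _ _ => 1 : Matrix (Fin m) (Fin n) K).zeroExt i j =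
      if (i : ℕ) ≤ m ∧ (j : ℕ) ≤ n then 1 else 0 := by
  induction i, j using zeroExt_cases m n with
  | hin a b => simp
  | hout i j h => rw [zeroExt_eq_zero _ h, if_neg (by omega)]

end Matrix

section EncodesMatrix

variable {K : Type w} [Zero K] {m n : ℕ} {A : Matrix (Fin m) (Fin n) K}

lemma encodesMatrix_two {R : (Fin 2 → ℕ+) → K} :
    EncodesMatrix A 2 R ↔ ∀ d d', R ![d, d'] = A.zeroExt d d' := by
  constructor
  · rintro ⟨h1, h2⟩ d d'
    induction d, d' using Matrix.zeroExt_cases m n with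
    | hin a b => simp [h1]
    | hout i j h => rw [h2 _ _ h, Matrix.zeroExt_eq_zero _ h]
  · intro h
    exact ⟨fun i j => by simp [h], fun d d' hd => by rw [h, Matrix.zeroExt_eq_zero _ hd]⟩

lemma encodesMatrix_col (hn : n = 1) {R : (Fin 1 → ℕ+) → K} :
    EncodesMatrix A 1 R ↔ ∀ d, R ![d] = A.zeroExt d 1 := by
  subst hn
  have one : (1 : ℕ+) = Nat.succPNat ((0 : Fin 1) : ℕ) := rfl
  constructor
  · rintro (⟨_, h1, h2⟩ | ⟨rfl, h1, h2⟩) d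
    · by_cases hd : (d : ℕ) ≤ m
      · obtain ⟨a, rfl⟩ := PNat.exists_fin_of_le hd
        rw [h1 a 0, one, Matrix.zeroExt_succPNat]
      · rw [h2 d (by omega), Matrix.zeroExt_eq_zero _ (Or.inl (by omega))]
    · by_cases hd : (d : ℕ) ≤ 1
      · obtain ⟨a, rfl⟩ := PNat.exists_fin_of_le hd
        rw [h1 a a, one, Matrix.zeroExt_succPNat, Subsingleton.elim 0 a]
      · rw [h2 d (by omega), Matrix.zeroExt_eq_zero _ (Or.inl (by omega))]
  · intro h
    refine Or.inl ⟨rfl, fun i j => ?_, fun d hd => ?_⟩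
    · rw [h, one, Matrix.zeroExt_succPNat, Subsingleton.elim 0 j]
    · rw [h, Matrix.zeroExt_eq_zero _ (Or.inl hd)]

lemma encodesMatrix_row (hm : m = 1) {R : (Fin 1 → ℕ+) → K} :
    EncodesMatrix A 1 R ↔ ∀ d, R ![d] = A.zeroExt 1 d := by
  have : EncodesMatrix A 1 R ↔ EncodesMatrix A.transpose 1 R := by
    constructor
    · rintro (⟨h, h1, h2⟩ | ⟨h, h1, h2⟩)
      · exact Or.inr ⟨h, fun i j => h1 j i, h2⟩
      · exact Or.inl ⟨h, fun i j => h1 j i, h2⟩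
    · rintro (⟨h, h1, h2⟩ | ⟨h, h1, h2⟩)
      · exact Or.inr ⟨h, fun i j => h1 j i, h2⟩
      · exact Or.inl ⟨h, fun i j => h1 j i, h2⟩
  rw [this, encodesMatrix_col hm]
  simp

lemma encodesMatrix_zero (hm : m = 1) (hn : n = 1) {R : (Fin 0 → ℕ+) → K} :
    EncodesMatrix A 0 R ↔ R ![] = A.zeroExt 1 1 := by
  subst hm hn
  have one : (1 : ℕ+) = Nat.succPNat ((0 : Fin 1) : ℕ) := rfl
  rw [one, Matrix.zeroExt_succPNat]
  constructor
  · rintro ⟨_, _, h⟩; exact h 0 0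
  · intro h
    refine ⟨rfl, rfl, fun i j => ?_⟩
    rw [h, Subsingleton.elim i 0, Subsingleton.elim j 0]

end EncodesMatrix

namespace Expr

variable {K : Type w} [CommSemiring K] {S : MatSchema.{u}}

/-- The value of an expression, extended by zero to all pairs of data values. -/
def val {α β : S.Size} (e : Expr S α β) (I : MatInstance K S) (i j : ℕ+) : K :=
  (e.eval I).zeroExt i j

variable {α β γ : S.Size} (I : MatInstance K S) (i j : ℕ+)

lemma val_eq_zero (e : Expr S α β) {i j : ℕ+} (h : I.dim α < i ∨ I.dim β < j) :
    e.val I i j = 0 :=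
  Matrix.zeroExt_eq_zero _ h

lemma val_transpose (e : Expr S α β) : e.transpose.val I i j = e.val I j i :=
  Matrix.zeroExt_transpose _ _ _

lemma val_mul (e₁ : Expr S α β) (e₂ : Expr S β γ) :
    (e₁.mul e₂).val I i j = ∑ d ∈ Finset.Icc 1 (I.dim β), e₁.val I i d * e₂.val I d j :=
  Matrix.zeroExt_mul _ _ _ _

lemma val_smul (e₁ : Expr S S.one S.one) (e₂ : Expr S α β) :
    (e₁.smul e₂).val I i j = e₁.val I 1 1 * e₂.val I i j := by
  have : ∀ h, e₁.val I 1 1 = e₁.eval I ⟨0, h⟩ ⟨0, h⟩ := fun h =>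
    Matrix.zeroExt_succPNat (e₁.eval I) ⟨0, h⟩ ⟨0, h⟩
  rw [this (I.dim S.one).pos]
  exact Matrix.zeroExt_smul _ _ _ _

lemma val_hadamard (e₁ e₂ : Expr S α β) :
    (e₁.hadamard e₂).val I i j = e₁.val I i j * e₂.val I i j :=
  Matrix.zeroExt_hadamard _ _ _ _

lemma val_ones : (ones α : Expr S α S.one).val I i j =
    if i ≤ I.dim α ∧ j ≤ 1 then 1 else 0 := by
  refine (Matrix.zeroExt_ones _ _).trans (if_congr ?_ rfl rfl)
  rw [I.dim_one, PNat.coe_le_coe, PNat.coe_le_coe]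

lemma val_ident : (ident α : Expr S α α).val I i j = if i = j ∧ i ≤ I.dim α then 1 else 0 :=
  Matrix.zeroExt_one _ _

end Expr

/-! ### Sums over sets of variables -/

section SumVars

variable {K : Type w} [CommSemiring K]

/-- The sum over the values of the variable `z` in the range `1, …, N z`. -/
def sumVar (N : ℕ → ℕ+) (z : ℕ) (F : (ℕ → ℕ+) → K) (ν : ℕ → ℕ+) : K :=
  ∑ d ∈ Finset.Icc 1 (N z), F (Function.update ν z d)

instance (N : ℕ → ℕ+) : LeftCommutative (sumVar (K := K) N) where
  left_comm y z F := by
    by_cases h : y = z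
    · rw [h]
    · funext ν
      simp only [sumVar]
      rw [Finset.sum_comm]
      simp only [Function.update_comm h]

/-- The sum over the values of the variables `z ∈ Y` in the ranges `1, …, N z`. -/
def sumVars (N : ℕ → ℕ+) (Y : Finset ℕ) (F : (ℕ → ℕ+) → K) : (ℕ → ℕ+) → K :=
  Y.val.foldr (sumVar N) F

variable (N : ℕ → ℕ+) {F G : (ℕ → ℕ+) → K}

@[simp]
lemma sumVars_empty : sumVars N ∅ F = F := rfl

lemma sumVars_insert {z : ℕ} {Y : Finset ℕ} (hz : z ∉ Y) :
    sumVars N (insert z Y) F = sumVar N z (sumVars N Y F) := by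
  rw [sumVars, Finset.insert_val_of_notMem hz, Multiset.foldr_cons]
  rfl

lemma sumVars_union {Y Z : Finset ℕ} (h : Disjoint Y Z) :
    sumVars N (Y ∪ Z) F = sumVars N Y (sumVars N Z F) := by
  induction Y using Finset.induction_on with
  | empty => simp
  | insert z Y hz ih =>
    rw [Finset.disjoint_insert_left] at h
    rw [Finset.insert_union, sumVars_insert, sumVars_insert _ hz, ih h.2]
    simp [hz, h.1]

/-- `F` does not depend on the variables in `Y`. -/
def IndepOf (F : (ℕ → ℕ+) → K) (Y : Finset ℕ) : Prop :=
  ∀ z ∈ Y, ∀ ν d, F (Function.update ν z d) = F ν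

lemma sumVars_mul_left {Y : Finset ℕ} (h : IndepOf F Y) :
    sumVars N Y (F * G) = F * sumVars N Y G := by
  induction Y using Finset.induction_on with
  | empty => simp
  | insert z Y hz ih =>
    rw [sumVars_insert _ hz, sumVars_insert _ hz,
      ih fun y hy => h y (Finset.mem_insert_of_mem hy)]
    funext ν
    simp only [sumVar, Pi.mul_apply, h z (Finset.mem_insert_self _ _), Finset.mul_sum]

lemma sumVars_mul_right {Y : Finset ℕ} (h : IndepOf G Y) :
    sumVars N Y (F * G) = sumVars N Y F * G := by
  rw [mul_comm, sumVars_mul_left N h, mul_comm]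

lemma sumVars_indepOf {Y Z : Finset ℕ} (h : IndepOf F Z) :
    IndepOf (sumVars N Y F) Z := by
  induction Y using Finset.induction_on with
  | empty => simpa
  | insert y Y hy ih =>
    intro z hz ν d
    rw [sumVars_insert _ hy, sumVar, sumVar]
    refine Finset.sum_congr rfl fun c _ => ?_
    by_cases hyz : y = z
    · rw [hyz, Function.update_idem]
    · rw [Function.update_comm (Ne.symm hyz), ih z hz]

lemma sumVars_eq_zero {Y : Finset ℕ} {z : ℕ} (hz : z ∉ Y) {ν : ℕ → ℕ+}
    (h : ∀ ν', ν' z = ν z → F ν' = 0) : sumVars N Y F ν = 0 := by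
  induction Y using Finset.induction_on generalizing ν with
  | empty => exact h ν rfl
  | insert y Y hy ih =>
    rw [Finset.mem_insert, not_or] at hz
    rw [sumVars_insert _ hy, sumVar]
    refine Finset.sum_eq_zero fun c _ => ih hz.2 fun ν' hν' => h ν' ?_
    rw [hν', Function.update_of_ne hz.1]

end SumVars

/-! ### Semantics of conjunctive queries in prenex form -/

section Eval

variable {K : Type w} [CommSemiring K] {σ : Vocabulary.{v}}

/-- The variables of a multiset of atoms. -/
def atomsVars (L : Multiset (Atom σ)) : Finset ℕ :=
  (L.map Atom.vars).sup

lemma mem_atomsVars {L : Multiset (Atom σ)} {z : ℕ} :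
    z ∈ atomsVars L ↔ ∃ a ∈ L, z ∈ a.vars := by
  induction L using Multiset.induction_on with
  | empty => simp [atomsVars]
  | cons a L ih =>
    rw [atomsVars] at ih
    simp [atomsVars, ih]

/-- The value of a conjunction of atoms. -/
def evalAtoms (db : Database K σ) (L : Multiset (Atom σ)) (ν : ℕ → ℕ+) : K :=
  (L.map fun a => a.eval db ν).prod

lemma evalAtoms_eq_zero {db : Database K σ} {L : Multiset (Atom σ)} {ν : ℕ → ℕ+} {a : Atom σ}
    (ha : a ∈ L) (h : a.eval db ν = 0) : evalAtoms db L ν = 0 := by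
  obtain ⟨L, rfl⟩ := Multiset.exists_cons_of_mem ha
  simp [evalAtoms, h]

lemma Atom.eval_congr {db : Database K σ} {a : Atom σ} {ν ν' : ℕ → ℕ+}
    (h : ∀ z ∈ a.vars, ν z = ν' z) : a.eval db ν = a.eval db ν' := by
  cases a with
  | rel R args =>
    simp only [Atom.eval]
    congr 1
    funext i
    exact h _ (by simp [Atom.vars])
  | le x c => simp [Atom.eval, h x (by simp [Atom.vars])]

lemma evalAtoms_indepOf {db : Database K σ} {L : Multiset (Atom σ)} {Y : Finset ℕ}
    (h : Disjoint Y (atomsVars L)) : IndepOf (evalAtoms db L) Y := by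
  intro z hz ν d
  refine congrArg Multiset.prod (Multiset.map_congr rfl fun a ha => Atom.eval_congr fun y hy => ?_)
  rw [Function.update_of_ne]
  rintro rfl
  exact Finset.disjoint_left.1 h hz (mem_atomsVars.2 ⟨a, ha, hy⟩)

lemma Formula.IsAtomConj.eval_eq {φ : Formula σ} (h : φ.IsAtomConj) (db : Database K σ)
    (ν : ℕ → ℕ+) : φ.eval db ν = evalAtoms db φ.atoms ν := by
  induction φ with
  | atom a => simp [Formula.eval, Formula.atoms, evalAtoms]
  | and φ ψ ih ih' =>
    rw [Formula.eval, ih h.1, ih' h.2]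
    simp [evalAtoms, Formula.atoms]
  | ex => exact h.elim

lemma Formula.IsAtomConj.free_eq {φ : Formula σ} (h : φ.IsAtomConj) :
    φ.free = atomsVars φ.atoms := by
  induction φ with
  | atom a => simp [Formula.free, Formula.atoms, atomsVars]
  | and φ ψ ih ih' =>
    rw [Formula.free, ih h.1, ih' h.2]
    simp [atomsVars, Formula.atoms]
  | ex => exact h.elim

lemma Formula.IsAtomConj.isPrenex {φ : Formula σ} (h : φ.IsAtomConj) : φ.IsPrenex := by
  cases φ <;> first | exact h | trivial

lemma Formula.IsPrenex.free_subset {φ : Formula σ} (h : φ.IsPrenex) :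
    φ.free ⊆ atomsVars φ.atoms := by
  induction φ with
  | atom a => exact (Formula.IsAtomConj.free_eq (φ := .atom a) trivial).subset
  | and φ ψ => exact (Formula.IsAtomConj.free_eq (φ := .and φ ψ) h).subset
  | ex y φ ih => exact (Finset.erase_subset _ _).trans (ih h)

/-- The value of a formula depends only on the values of its free variables. -/
lemma Formula.eval_congr {φ : Formula σ} {db : Database K σ} {ν ν' : ℕ → ℕ+}
    (h : ∀ z ∈ φ.free, ν z = ν' z) : φ.eval db ν = φ.eval db ν' := by
  induction φ generalizing ν ν' with
  | atom a => exact Atom.eval_congr h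
  | and φ ψ ih ih' =>
    rw [Formula.eval, Formula.eval, ih fun z hz => h z (Finset.mem_union_left _ hz),
      ih' fun z hz => h z (Finset.mem_union_right _ hz)]
  | ex y φ ih =>
    rw [Formula.eval, Formula.eval]
    split_ifs with hy
    · refine finsum_congr fun d => ih fun z hz => ?_
      by_cases hzy : z = y
      · rw [hzy, Function.update_self, Function.update_self]
      · rw [Function.update_of_ne hzy, Function.update_of_ne hzy]
        exact h z (Finset.mem_erase.2 ⟨hzy, hz⟩)
    · exact ih fun z hz => h z (Finset.mem_erase.2 ⟨fun hzy => hy (hzy ▸ hz), hz⟩)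

lemma Query.eval_comp_head {k : ℕ} (Q : Query σ k) (db : Database K σ) (ν : ℕ → ℕ+) :
    Q.eval db (fun i => ν (Q.head i)) = Q.body.eval db ν := by
  rw [Query.eval, if_pos fun i j h => by rw [h]]
  refine Formula.eval_congr fun z hz => ?_
  rw [Q.free_body, Finset.mem_image] at hz
  obtain ⟨i, -, rfl⟩ := hz
  exact Function.FactorsThrough.extend_apply (fun i j h => by simp only [h]) _ i

lemma Query.eval_eq_zero {k : ℕ} (Q : Query σ k) (db : Database K σ) {d : Fin k → ℕ+} {i j : Fin k}
    (h : Q.head i = Q.head j) (hd : d i ≠ d j) : Q.eval db d = 0 :=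
  if_neg fun h' => hd (h' i j h)

/-- A prenex formula is the sum, over its bound variables, of the conjunction of its atoms, provided
that atoms vanish as soon as one of their variables is out of range. -/
lemma Formula.IsPrenex.eval_eq {φ : Formula σ} (h : φ.IsPrenex) (db : Database K σ) (N : ℕ → ℕ+)
    (hN : ∀ a ∈ φ.atoms, ∀ z ∈ a.vars, ∀ ν : ℕ → ℕ+, N z < ν z → a.eval db ν = 0) :
    φ.eval db = sumVars N (atomsVars φ.atoms \ φ.free) (evalAtoms db φ.atoms) := by
  have conj : ∀ {ψ : Formula σ}, ψ.IsAtomConj →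
      ψ.eval db = sumVars N (atomsVars ψ.atoms \ ψ.free) (evalAtoms db ψ.atoms) := by
    intro ψ h
    rw [h.free_eq, Finset.sdiff_self, sumVars_empty]
    exact funext (h.eval_eq db)
  induction φ with
  | atom a => exact conj trivial
  | and φ ψ => exact conj h
  | ex y φ ih =>
    have ih := ih h hN
    funext ν
    rw [Formula.eval]
    split_ifs with hy
    · have hset : atomsVars (Formula.ex y φ).atoms \ (Formula.ex y φ).free
          = insert y (atomsVars φ.atoms \ φ.free) := by
        have := Formula.IsPrenex.free_subset (φ := φ) h hy
        ext z
        simp only [Formula.atoms, Formula.free, Finset.mem_sdiff, Finset.mem_erase,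
          Finset.mem_insert]
        grind
      rw [hset, sumVars_insert _ (by simp [hy]), sumVar, ih]
      refine finsum_eq_sum_of_support_subset _ fun d hd => ?_
      rw [Finset.coe_Icc, Set.mem_Icc]
      refine ⟨one_le, not_lt.1 fun hlt => hd ?_⟩
      obtain ⟨a, ha, hya⟩ := mem_atomsVars.1 (Formula.IsPrenex.free_subset (φ := φ) h hy)
      refine sumVars_eq_zero N (z := y) (by simp [hy]) fun ν' hν' =>
        evalAtoms_eq_zero ha (hN a ha y hya ν' ?_)
      rw [hν']
      simpa using hlt
    · rw [ih]
      simp only [Formula.atoms, Formula.free, Finset.erase_eq_of_notMem hy]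

lemma Formula.IsAtomConj.atomTyped {S : MatSchema.{u}} {E : SchemaEncoding S σ} {φ : Formula σ}
    (h : φ.IsAtomConj) {τ : ℕ → S.Size} (hτ : E.Typed φ τ) : ∀ a ∈ φ.atoms, E.AtomTyped τ a := by
  induction φ with
  | atom a => intro b hb; rw [Multiset.mem_singleton.1 hb]; exact hτ
  | and φ ψ ih ih' =>
    intro a ha
    rcases Multiset.mem_add.1 ha with ha | ha
    · exact ih h.1 hτ.1 a ha
    · exact ih' h.2 hτ.2 a ha
  | ex => exact h.elim

/-- A typing of a prenex formula is a typing of its atoms, up to the types of bound variables. -/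
lemma SchemaEncoding.Typed.exists_atomTyped {S : MatSchema.{u}} {E : SchemaEncoding S σ}
    {φ : Formula σ} (h : φ.IsPrenex) {τ : ℕ → S.Size} (hτ : E.Typed φ τ) :
    ∃ τ' : ℕ → S.Size, (∀ z ∈ φ.free, τ' z = τ z) ∧ ∀ a ∈ φ.atoms, E.AtomTyped τ' a := by
  induction φ generalizing τ with
  | atom a => exact ⟨τ, fun _ _ => rfl, Formula.IsAtomConj.atomTyped (φ := .atom a) trivial hτ⟩
  | and φ ψ => exact ⟨τ, fun _ _ => rfl, Formula.IsAtomConj.atomTyped (φ := .and φ ψ) h hτ⟩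
  | ex y φ ih =>
    obtain ⟨α, hα⟩ := hτ
    obtain ⟨τ', h1, h2⟩ := ih h hα
    refine ⟨τ', fun z hz => ?_, h2⟩
    obtain ⟨hzy, hz⟩ := Finset.mem_erase.1 hz
    rw [h1 z hz, Function.update_of_ne hzy]

end Eval

/-! ### From free-connex conjunctive queries to expressions -/

section IsMatlang

variable {K : Type w} [CommSemiring K] {S : MatSchema.{u}} {σ : Vocabulary.{v}}

/-- The pairs of a matrix instance and a database that correspond to each other. -/
abbrev SchemaEncoding.Inputs (E : SchemaEncoding S σ) (K : Type w) [CommSemiring K] :=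
  {p : MatInstance K S × Database K σ // E.Encodes p.1 p.2}

/-- The ranges of variables of the types `τ`. -/
def SchemaEncoding.Inputs.dims {E : SchemaEncoding S σ} (τ : ℕ → S.Size) (P : E.Inputs K)
    (z : ℕ) : ℕ+ :=
  P.1.1.dim (τ z)

/-- `F`, a function of the variables in `X` (at most two of them, of the types `τ`), is the value of
an fc-MATLANG expression: a scalar, a column vector or a matrix, depending on the size of `X`. In
particular `F` vanishes when a variable in `X` is out of range. -/
def IsMatlang (E : SchemaEncoding S σ) (τ : ℕ → S.Size) (X : Finset ℕ)
    (F : E.Inputs K → (ℕ → ℕ+) → K) : Prop :=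
  (X = ∅ ∧ ∃ e : Expr S S.one S.one, e.IsFC ∧ ∀ P ν, F P ν = e.val P.1.1 1 1) ∨
  (∃ x, X = {x} ∧ ∃ e : Expr S (τ x) S.one, e.IsFC ∧ ∀ P ν, F P ν = e.val P.1.1 (ν x) 1) ∨
  (∃ x y, x ≠ y ∧ X = {x, y} ∧
    ∃ e : Expr S (τ x) (τ y), e.IsFC ∧ ∀ P ν, F P ν = e.val P.1.1 (ν x) (ν y))

namespace IsMatlang

variable {E : SchemaEncoding S σ} {τ : ℕ → S.Size} {X Y : Finset ℕ}
  {F G : E.Inputs K → (ℕ → ℕ+) → K}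

lemma exists_scalar (h : IsMatlang E τ ∅ F) :
    ∃ e : Expr S S.one S.one, e.IsFC ∧ ∀ P ν, F P ν = e.val P.1.1 1 1 := by
  rcases h with ⟨-, h⟩ | ⟨x, hx, -⟩ | ⟨x, y, -, hx, -⟩
  · exact h
  · exact absurd hx.symm (Finset.singleton_ne_empty x)
  · exact absurd hx.symm (Finset.insert_ne_empty _ _)

lemma exists_vector {x : ℕ} (h : IsMatlang E τ {x} F) :
    ∃ e : Expr S (τ x) S.one, e.IsFC ∧ ∀ P ν, F P ν = e.val P.1.1 (ν x) 1 := by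
  rcases h with ⟨hx, -⟩ | ⟨y, hx, h⟩ | ⟨y, z, hyz, hx, -⟩
  · exact absurd hx (Finset.singleton_ne_empty x)
  · obtain rfl := Finset.singleton_injective hx
    exact h
  · have := congrArg Finset.card hx
    rw [Finset.card_singleton, Finset.card_pair hyz] at this
    omega

lemma exists_matrix {x y : ℕ} (hxy : x ≠ y) (h : IsMatlang E τ {x, y} F) :
    ∃ e : Expr S (τ x) (τ y), e.IsFC ∧ ∀ P ν, F P ν = e.val P.1.1 (ν x) (ν y) := by
  rcases h with ⟨hx, -⟩ | ⟨z, hx, -⟩ | ⟨z, w, hzw, hx, e, he, h⟩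
  · exact absurd hx (Finset.insert_ne_empty _ _)
  · have := congrArg Finset.card hx
    rw [Finset.card_singleton, Finset.card_pair hxy] at this
    omega
  · have hx1 : x = z ∨ x = w := by simpa using hx.subset (Finset.mem_insert_self x {y})
    have hy1 : y = z ∨ y = w := by
      simpa using hx.subset (Finset.mem_insert_of_mem (Finset.mem_singleton_self y))
    rcases hx1 with rfl | rfl <;> rcases hy1 with rfl | rfl
    · exact absurd rfl hxy
    · exact ⟨e, he, h⟩
    · exact ⟨e.transpose, he, fun P ν => by rw [h, Expr.val_transpose]⟩
    · exact absurd rfl hxy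

lemma eq_zero (h : IsMatlang E τ X F) {x : ℕ} (hx : x ∈ X) {P : E.Inputs K} {ν : ℕ → ℕ+}
    (hν : P.dims τ x < ν x) : F P ν = 0 := by
  rw [SchemaEncoding.Inputs.dims, ← PNat.coe_lt_coe] at hν
  rcases h with ⟨rfl, -⟩ | ⟨y, rfl, e, -, h⟩ | ⟨y, z, -, rfl, e, -, h⟩
  · simp at hx
  · rw [Finset.mem_singleton] at hx
    subst hx
    rw [h, Expr.val_eq_zero _ _ (Or.inl (PNat.coe_lt_coe _ _ |>.1 hν))]
  · rw [Finset.mem_insert, Finset.mem_singleton] at hx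
    rw [h, Expr.val_eq_zero]
    rcases hx with rfl | rfl
    · exact Or.inl hν
    · exact Or.inr hν

lemma indepOf (h : IsMatlang E τ X F) (hXY : Disjoint Y X) (P : E.Inputs K) : IndepOf (F P) Y := by
  intro z hz ν d
  have hzX : z ∉ X := Finset.disjoint_left.1 hXY hz
  rcases h with ⟨rfl, e, -, h⟩ | ⟨y, rfl, e, -, h⟩ | ⟨y, y', -, rfl, e, -, h⟩
  · rw [h, h]
  · rw [Finset.mem_singleton] at hzX
    rw [h, h, Function.update_of_ne (Ne.symm hzX)]
  · rw [Finset.mem_insert, Finset.mem_singleton, not_or] at hzX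
    rw [h, h, Function.update_of_ne (Ne.symm hzX.1), Function.update_of_ne (Ne.symm hzX.2)]

lemma mul (hF : IsMatlang E τ X F) (hG : IsMatlang E τ Y G) (hYX : Y ⊆ X) :
    IsMatlang E τ X (F * G) := by
  have smul : ∀ {α β : S.Size} (e : Expr S α β), e.IsFC → Y = ∅ →
      ∃ e' : Expr S α β, e'.IsFC ∧ ∀ P ν i j, e'.val P.1.1 i j = e.val P.1.1 i j * G P ν := by
    rintro α β e he rfl
    obtain ⟨e', he', h'⟩ := hG.exists_scalar
    exact ⟨e'.smul e, ⟨he', he⟩, fun P ν i j => by rw [h', Expr.val_smul, mul_comm]⟩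
  rcases hF with ⟨rfl, e, he, h⟩ | ⟨x, rfl, e, he, h⟩ | ⟨x, y, hxy, rfl, e, he, h⟩
  · obtain ⟨e', he', h'⟩ := smul e he (Finset.subset_empty.1 hYX)
    exact Or.inl ⟨rfl, e', he', fun P ν => by rw [h' P ν, Pi.mul_apply, Pi.mul_apply, h]⟩
  · refine Or.inr (Or.inl ⟨x, rfl, ?_⟩)
    rcases Finset.subset_singleton_iff.1 hYX with hY | rfl
    · obtain ⟨e', he', h'⟩ := smul e he hY
      exact ⟨e', he', fun P ν => by rw [h' P ν, Pi.mul_apply, Pi.mul_apply, h]⟩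
    · obtain ⟨e', he', h'⟩ := hG.exists_vector
      exact ⟨e.hadamard e', ⟨he, he'⟩, fun P ν => by
        rw [Expr.val_hadamard, Pi.mul_apply, Pi.mul_apply, h, h']⟩
  · refine Or.inr (Or.inr ⟨x, y, hxy, rfl, ?_⟩)
    have cases : Y = ∅ ∨ Y = {x} ∨ Y = {y} ∨ Y = {x, y} := by
      by_cases hx : x ∈ Y <;> by_cases hy : y ∈ Y
      · refine Or.inr (Or.inr (Or.inr (Finset.Subset.antisymm hYX ?_)))
        simp [Finset.insert_subset_iff, hx, hy]
      all_goals
        have := fun z (hz : z ∈ Y) => Finset.mem_insert.1 (hYX hz)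
        simp only [Finset.mem_singleton] at this
      · refine Or.inr (Or.inl (Finset.eq_singleton_iff_unique_mem.2 ⟨hx, fun z hz => ?_⟩))
        grind
      · refine Or.inr (Or.inr (Or.inl (Finset.eq_singleton_iff_unique_mem.2 ⟨hy, fun z hz => ?_⟩)))
        grind
      · refine Or.inl (Finset.eq_empty_of_forall_notMem fun z hz => ?_)
        grind
    -- in the remaining cases `e` is multiplied entrywise by a matrix with constant rows or columns
    rcases cases with hY | rfl | rfl | rfl
    · obtain ⟨e', he', h'⟩ := smul e he hY
      exact ⟨e', he', fun P ν => by rw [h' P ν, Pi.mul_apply, Pi.mul_apply, h]⟩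
    · obtain ⟨e', he', h'⟩ := hG.exists_vector
      refine ⟨e.hadamard (e'.mul (Expr.ones (τ y)).transpose),
        ⟨he, he', trivial, Or.inl (Or.inr rfl)⟩, fun P ν => ?_⟩
      rw [Expr.val_hadamard, Pi.mul_apply, Pi.mul_apply, h, h', Expr.val_mul, P.1.1.dim_one,
        Finset.Icc_self, Finset.sum_singleton, Expr.val_transpose, Expr.val_ones]
      by_cases hy : ν y ≤ P.1.1.dim (τ y)
      · simp [hy]
      · rw [Expr.val_eq_zero _ e (Or.inr (not_le.1 hy)), zero_mul, zero_mul]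
    · obtain ⟨e', he', h'⟩ := hG.exists_vector
      refine ⟨e.hadamard ((Expr.ones (τ x)).mul e'.transpose),
        ⟨he, trivial, he', Or.inl (Or.inr rfl)⟩, fun P ν => ?_⟩
      rw [Expr.val_hadamard, Pi.mul_apply, Pi.mul_apply, h, h', Expr.val_mul, P.1.1.dim_one,
        Finset.Icc_self, Finset.sum_singleton, Expr.val_transpose, Expr.val_ones]
      by_cases hx : ν x ≤ P.1.1.dim (τ x)
      · simp [hx]
      · rw [Expr.val_eq_zero _ e (Or.inl (not_le.1 hx)), zero_mul, zero_mul]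
    · obtain ⟨e', he', h'⟩ := hG.exists_matrix hxy
      exact ⟨e.hadamard e', ⟨he, he'⟩, fun P ν => by
        rw [Expr.val_hadamard, Pi.mul_apply, Pi.mul_apply, h, h']⟩

lemma pow (hF : IsMatlang E τ X F) {n : ℕ} (hn : n ≠ 0) : IsMatlang E τ X (F ^ n) := by
  induction n with
  | zero => exact absurd rfl hn
  | succ n ih =>
    rcases Nat.eq_zero_or_pos n with rfl | h
    · simpa using hF
    · rw [pow_succ]
      exact (ih h.ne').mul hF subset_rfl

/-- Summing over a variable is the multiplication by an all-ones vector. -/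
lemma sumVar (hF : IsMatlang E τ X F) {z : ℕ} (hz : z ∈ X) :
    IsMatlang E τ (X.erase z) (fun P => sumVar (P.dims τ) z (F P)) := by
  rcases hF with ⟨rfl, -⟩ | ⟨x, rfl, e, he, h⟩ | ⟨x, y, hxy, rfl, e, he, h⟩
  · simp at hz
  · obtain rfl := Finset.mem_singleton.1 hz
    refine Or.inl ⟨by simp, (Expr.ones (τ z)).transpose.mul e, ⟨trivial, he, Or.inl (Or.inl rfl)⟩,
      fun P ν => ?_⟩
    rw [Expr.val_mul]
    refine Finset.sum_congr rfl fun d hd => ?_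
    rw [h, Function.update_self, Expr.val_transpose, Expr.val_ones,
      if_pos ⟨(Finset.mem_Icc.1 hd).2, le_rfl⟩, one_mul]
  · rw [Finset.mem_insert, Finset.mem_singleton] at hz
    rcases hz with rfl | rfl
    · refine Or.inr (Or.inl ⟨y, by simp [hxy], e.transpose.mul (Expr.ones (τ z)),
        ⟨he, trivial, Or.inr (Or.inr rfl)⟩, fun P ν => ?_⟩)
      rw [Expr.val_mul]
      refine Finset.sum_congr rfl fun d hd => ?_
      rw [h, Function.update_self, Function.update_of_ne (Ne.symm hxy), Expr.val_transpose,
        Expr.val_ones, if_pos ⟨(Finset.mem_Icc.1 hd).2, le_rfl⟩, mul_one]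
    · refine Or.inr (Or.inl ⟨x, ?_, e.mul (Expr.ones (τ z)),
        ⟨he, trivial, Or.inr (Or.inr rfl)⟩, fun P ν => ?_⟩)
      · rw [Finset.pair_comm, Finset.erase_insert (by simpa using Ne.symm hxy)]
      rw [Expr.val_mul]
      refine Finset.sum_congr rfl fun d hd => ?_
      rw [h, Function.update_self, Function.update_of_ne hxy,
        Expr.val_ones, if_pos ⟨(Finset.mem_Icc.1 hd).2, le_rfl⟩, mul_one]

lemma sumVars (hF : IsMatlang E τ X F) (hY : Y ⊆ X) :
    IsMatlang E τ (X \ Y) (fun P => sumVars (P.dims τ) Y (F P)) := by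
  induction Y using Finset.induction_on with
  | empty => simpa
  | insert z Y hz ih =>
    rw [Finset.insert_subset_iff] at hY
    simp only [sumVars_insert _ hz]
    rw [Finset.sdiff_insert]
    exact (ih hY.2).sumVar (by simp [hz, hY.1])

/-- The indicator function of the ranges of at most two variables. -/
lemma range (E : SchemaEncoding S σ) (τ : ℕ → S.Size) (hX : X.card ≤ 2) :
    IsMatlang E τ X (fun P ν => if ∀ x ∈ X, ν x ≤ P.dims τ x then (1 : K) else 0) := by
  have cases : X.card = 0 ∨ X.card = 1 ∨ X.card = 2 := by omega
  rcases cases with h | h | h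
  · rw [Finset.card_eq_zero] at h
    subst h
    refine Or.inl ⟨rfl, Expr.ones S.one, trivial, fun P ν => ?_⟩
    rw [Expr.val_ones]
    simp
  · obtain ⟨x, rfl⟩ := Finset.card_eq_one.1 h
    refine Or.inr (Or.inl ⟨x, rfl, Expr.ones (τ x), trivial, fun P ν => ?_⟩)
    rw [Expr.val_ones]
    simp [SchemaEncoding.Inputs.dims]
  · obtain ⟨x, y, hxy, rfl⟩ := Finset.card_eq_two.1 h
    refine Or.inr (Or.inr ⟨x, y, hxy, rfl, (Expr.ones (τ x)).mul (Expr.ones (τ y)).transpose,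
      ⟨trivial, trivial, Or.inl (Or.inr rfl)⟩, fun P ν => ?_⟩)
    rw [Expr.val_mul, P.1.1.dim_one, Finset.Icc_self, Finset.sum_singleton, Expr.val_transpose,
      Expr.val_ones, Expr.val_ones]
    by_cases h1 : ν x ≤ P.1.1.dim (τ x) <;> by_cases h2 : ν y ≤ P.1.1.dim (τ y) <;>
      simp [SchemaEncoding.Inputs.dims, h1, h2]

/-- The value of a typed relational atom, for any relation that encodes the value of an
expression. -/
lemma relAtom {t : S.Size × S.Size} {e : Expr S t.1 t.2} (he : e.IsFC) {k : ℕ} {args : Fin k → ℕ}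
    (ht : S.ArgsTyped t k fun i => τ (args i)) {R : E.Inputs K → (Fin k → ℕ+) → K}
    (hR : ∀ P, EncodesMatrix (e.eval P.1.1) k (R P)) :
    IsMatlang E τ (Finset.univ.image args) (fun P ν => R P fun i => ν (args i)) := by
  obtain ⟨α, β⟩ := t
  have one : ∀ P : E.Inputs K, (P.1.1.dim S.one : ℕ) = 1 := fun P => by rw [P.1.1.dim_one]; rfl
  match k, args, R, ht, hR with
  | 0, args, R, ht, hR =>
    obtain ⟨rfl, rfl⟩ := Prod.mk.inj ht
    refine Or.inl ⟨by simp, e, he, fun P ν => ?_⟩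
    beta_reduce
    rw [Subsingleton.elim (fun i => ν (args i)) ![]]
    exact (encodesMatrix_zero (one P) (one P)).1 (hR P)
  | 1, args, R, ht, hR =>
    refine Or.inr (Or.inl ⟨args 0, by simp, ?_⟩)
    have vec : ∀ ν : ℕ → ℕ+, (fun i => ν (args i)) = ![ν (args 0)] := fun ν => by
      funext i; rw [Subsingleton.elim i 0]; rfl
    rcases ht with ht | ht
    · obtain ⟨rfl, rfl⟩ := Prod.mk.inj ht
      refine ⟨e, he, fun P ν => ?_⟩
      beta_reduce
      rw [vec]
      exact (encodesMatrix_col (one P)).1 (hR P) _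
    · obtain ⟨rfl, rfl⟩ := Prod.mk.inj ht
      refine ⟨e.transpose, he, fun P ν => ?_⟩
      beta_reduce
      rw [vec, Expr.val_transpose]
      exact (encodesMatrix_row (one P)).1 (hR P) _
  | 2, args, R, ht, hR =>
    obtain ⟨h0, h1⟩ := Prod.mk.inj ht
    simp only at h0 h1
    have vec : ∀ ν : ℕ → ℕ+, (fun i => ν (args i)) = ![ν (args 0), ν (args 1)] := fun ν => by
      funext i; fin_cases i <;> rfl
    have hRe : ∀ (P : E.Inputs K) (ν : ℕ → ℕ+),
        R P (fun i => ν (args i)) = e.val P.1.1 (ν (args 0)) (ν (args 1)) := fun P ν => by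
      rw [vec]
      exact encodesMatrix_two.1 (hR P) _ _
    have himage : Finset.univ.image args = {args 0, args 1} := by
      ext z; simp [eq_comm, Fin.exists_fin_two]
    rw [himage]
    simp only [hRe]
    clear hRe vec hR himage
    generalize args 0 = x at *
    generalize args 1 = y at *
    subst h0 h1
    by_cases hxy : x = y
    · subst hxy
      -- the diagonal of `e`, as a column vector
      refine Or.inr (Or.inl ⟨x, by simp, (e.hadamard (Expr.ident (τ x))).mul (Expr.ones (τ x)),
        ⟨⟨he, trivial⟩, trivial, Or.inr (Or.inr rfl)⟩, fun P ν => ?_⟩)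
      rw [Expr.val_mul]
      by_cases hx : ν x ≤ P.1.1.dim (τ x)
      · rw [Finset.sum_eq_single (ν x)]
        · simp [Expr.val_hadamard, Expr.val_ident, Expr.val_ones, hx]
        · intro d _ hd
          simp [Expr.val_hadamard, Expr.val_ident, Ne.symm hd]
        · intro h
          exact absurd (Finset.mem_Icc.2 ⟨one_le, hx⟩) h
      · beta_reduce
        rw [Expr.val_eq_zero _ _ (Or.inl (not_le.1 hx))]
        refine (Finset.sum_eq_zero fun d _ => ?_).symm
        rw [Expr.val_eq_zero _ _ (Or.inl (not_le.1 hx)), zero_mul]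
    · exact Or.inr (Or.inr ⟨x, y, hxy, rfl, e, he, fun _ _ => rfl⟩)
  | _ + 3, _, _, ht, _ => exact ht.elim

/-- The value of a typed atom. -/
lemma atom {a : Atom σ} (ha : E.AtomTyped τ a) :
    IsMatlang E τ a.vars (fun (P : E.Inputs K) ν => a.eval P.1.2 ν) := by
  cases a with
  | rel R args =>
    obtain ⟨A, rfl⟩ := E.mat.surjective R
    have ht : S.ArgsTyped (S.ty A) _ fun i => τ (args i) := by
      simpa [SchemaEncoding.AtomTyped] using ha
    exact relAtom (e := Expr.sym A) trivial ht fun P => P.2.1 A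
  | le x c =>
    refine Or.inr (Or.inl ⟨x, rfl, Expr.ones (τ x), trivial, fun P ν => ?_⟩)
    have hc : P.1.2.const c = P.1.1.dim (τ x) := by
      have := P.2.2 (τ x)
      have ha : τ x = E.size.symm c := ha
      rw [ha, Equiv.apply_symm_apply] at this
      rw [ha, this]
    simp [Atom.eval, Expr.val_ones, hc]

/-- Evaluation along a join tree (Yannakakis' algorithm): the last node `a`, a leaf, is summed over
the variables that it does not share with its parent and then multiplied into the parent. -/
lemma joinSet {V : Type*} [DecidableEq V] {vars : V → Finset ℕ} {r : V} {s : Finset V}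
    (h : JoinSet vars r s) (F : V → E.Inputs K → (ℕ → ℕ+) → K)
    (hF : ∀ a ∈ s, IsMatlang E τ (vars a) (F a)) :
    IsMatlang E τ (vars r)
      (fun P => _root_.sumVars (P.dims τ) (s.biUnion vars \ vars r) (∏ a ∈ s, F a P)) := by
  induction h generalizing F with
  | root => simpa using hF r
  | @insert s a p h hp hap ih =>
    by_cases ha : a ∈ s
    · rw [Finset.insert_eq_of_mem ha] at hF ⊢
      exact ih F hF
    have hap' : ∀ z ∈ vars a, ∀ b ∈ s, z ∈ vars b → z ∈ vars p := fun z hz b hb hzb =>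
      hap z hz ⟨b, hb, hzb⟩
    have hFs : ∀ b ∈ s, IsMatlang E τ (vars b) (F b) := fun b hb =>
      hF b (Finset.mem_insert_of_mem hb)
    set A := vars a \ vars p with hA
    have hsum := (hF a (Finset.mem_insert_self a s)).sumVars (Y := A) Finset.sdiff_subset
    have hmul := (hFs p hp).mul hsum (by
      intro z hz
      simp only [hA, Finset.mem_sdiff] at hz
      tauto)
    set F' := Function.update F p (F p * fun P => _root_.sumVars (P.dims τ) A (F a P)) with hF'
    have hF'p : F' p = F p * fun P => _root_.sumVars (P.dims τ) A (F a P) := by simp [hF']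
    have hF'b : ∀ b, b ≠ p → F' b = F b := fun b hb => by simp [hF', hb]
    have key := ih F'
      (by
        intro b hb
        by_cases hbp : b = p
        · subst hbp; rw [hF'p]; exact hmul
        · rw [hF'b b hbp]; exact hFs b hb)
    convert key using 2 with P
    have hset : (insert a s).biUnion vars \ vars r = (s.biUnion vars \ vars r) ∪ A := by
      ext z
      have := hap' z
      have hr := h.root_mem
      simp only [Finset.biUnion_insert, Finset.mem_sdiff, Finset.mem_union, Finset.mem_biUnion, hA]
      grind
    have hdisj : Disjoint (s.biUnion vars \ vars r) A := by
      rw [Finset.disjoint_left]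
      intro z hz hzA
      have := hap' z
      simp only [Finset.mem_sdiff, Finset.mem_biUnion, hA] at hz hzA
      grind
    rw [hset, sumVars_union _ hdisj]
    congr 1
    have hind : IndepOf (∏ b ∈ s, F b P) A := by
      intro z hz ν d
      simp only [Finset.prod_apply]
      refine Finset.prod_congr rfl fun b hb => (hFs b hb).indepOf ?_ P z hz ν d
      rw [Finset.disjoint_left]
      intro y hy hyb
      rw [hA, Finset.mem_sdiff] at hy
      exact hy.2 (hap' y hy.1 b hb hyb)
    rw [Finset.prod_insert ha, mul_comm, sumVars_mul_left _ hind,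
      ← Finset.mul_prod_erase s _ hp, ← Finset.mul_prod_erase s _ hp, hF'p,
      Finset.prod_congr rfl
        (fun b hb => congrFun (hF'b b (Finset.ne_of_mem_erase hb)) P),
      Pi.mul_apply, mul_right_comm]

/-- A function of the head variables that is the value of an expression gives the output relation of
a query. -/
lemma exists_expr {k : ℕ} {head : Fin k → ℕ} {α β : S.Size}
    (ht : S.ArgsTyped (α, β) k fun i => τ (head i)) (hF : IsMatlang E τ (Finset.univ.image head) F)
    {R : E.Inputs K → (Fin k → ℕ+) → K}
    (hR : ∀ P ν, R P (fun i => ν (head i)) = F P ν)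
    (hR' : ∀ P d, ∀ i j, head i = head j → d i ≠ d j → R P d = 0) :
    ∃ e : Expr S α β, e.IsFC ∧ ∀ P, EncodesMatrix (e.eval P.1.1) k (R P) := by
  have one : ∀ P : E.Inputs K, (P.1.1.dim S.one : ℕ) = 1 := fun P => by rw [P.1.1.dim_one]; rfl
  match k, head, R, ht, hF, hR, hR' with
  | 0, head, R, ht, hF, hR, _ =>
    obtain ⟨rfl, rfl⟩ := Prod.mk.inj ht
    obtain ⟨e, he, h⟩ := exists_scalar (by simpa using hF)
    refine ⟨e, he, fun P => (encodesMatrix_zero (one P) (one P)).2 ?_⟩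
    rw [Subsingleton.elim ![] fun i => (1 : ℕ+), hR P fun _ => 1, h]
    rfl
  | 1, head, R, ht, hF, hR, _ =>
    obtain ⟨e, he, h⟩ := exists_vector (x := head 0) (by simpa using hF)
    have hRe : ∀ P d, R P ![d] = e.val P.1.1 d 1 := fun P d => by
      rw [← h P fun _ => d, ← hR]
      congr 1
      funext i
      rw [Subsingleton.elim i 0]
      rfl
    rcases ht with ht | ht
    · obtain ⟨rfl, rfl⟩ := Prod.mk.inj ht
      exact ⟨e, he, fun P => (encodesMatrix_col (one P)).2 (hRe P)⟩
    · obtain ⟨rfl, rfl⟩ := Prod.mk.inj ht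
      refine ⟨e.transpose, he, fun P => (encodesMatrix_row (one P)).2 fun d => ?_⟩
      rw [hRe]
      exact (Expr.val_transpose _ _ _ e).symm
  | 2, head, R, ht, hF, hR, hR' =>
    obtain ⟨rfl, rfl⟩ := Prod.mk.inj ht
    have himage : Finset.univ.image head = {head 0, head 1} := by
      ext z; simp [eq_comm, Fin.exists_fin_two]
    rw [himage] at hF
    by_cases hxy : head 0 = head 1
    · obtain ⟨e, he, h⟩ := exists_vector (x := head 0) (by simpa [← hxy] using hF)
      have diag : ∀ α, τ (head 0) = α → ∃ e' : Expr S (τ (head 0)) α, e'.IsFC ∧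
          ∀ (P : E.Inputs K) d d', e'.val P.1.1 d d' = if d = d' then e.val P.1.1 d 1 else 0 := by
        rintro _ rfl
        refine ⟨(e.mul (Expr.ones _).transpose).hadamard (Expr.ident _),
          ⟨⟨he, trivial, Or.inl (Or.inr rfl)⟩, trivial⟩, fun P d d' => ?_⟩
        rw [Expr.val_hadamard, Expr.val_mul, P.1.1.dim_one, Finset.Icc_self,
          Finset.sum_singleton, Expr.val_transpose, Expr.val_ones, Expr.val_ident]
        by_cases hd : d = d'
        · subst hd
          by_cases hr : d ≤ P.1.1.dim (τ (head 0))
          · simp [hr]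
          · simp [hr, Expr.val_eq_zero _ e (Or.inl (not_le.1 hr))]
        · simp [hd]
      obtain ⟨e', he', h'⟩ := diag _ (congrArg τ hxy)
      refine ⟨e', he', fun P => encodesMatrix_two.2 fun d d' => ?_⟩
      refine Eq.trans ?_ (h' P d d').symm
      split_ifs with hd
      · subst hd
        rw [← h P fun _ => d, ← hR]
        congr 1
        funext i
        fin_cases i <;> rfl
      · exact hR' P _ 0 1 hxy (by simpa using hd)
    · obtain ⟨e, he, h⟩ := exists_matrix hxy hF
      refine ⟨e, he, fun P => encodesMatrix_two.2 fun d d' => ?_⟩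
      have := h P fun z => if z = head 0 then d else d'
      simp only [if_true, if_neg (Ne.symm hxy)] at this
      refine Eq.trans ?_ this
      rw [← hR]
      congr 1
      funext i
      fin_cases i
      · simp
      · simp [Ne.symm hxy]
  | _ + 3, _, _, ht, _, _, _ => exact ht.elim

end IsMatlang

end IsMatlang

/-- Every binary conjunctive query whose extension by the head atom is acyclic is equivalent to an
fc-MATLANG expression. The join tree is rooted at the head atom, which stands for the indicator
function of the ranges of the head variables. -/
theorem exists_expr_of_query {K : Type w} [CommSemiring K] {S : MatSchema.{u}} {σ : Vocabulary.{v}}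
    {E : SchemaEncoding S σ} {k : ℕ} {Q : Query σ k} {α β : S.Size} (hk : k ≤ 2) (hQ : Q.IsCQ)
    (hT : HasJoinTree Q.atomVarsWithHead) (ht : E.QueryTyped (α, β) Q) :
    ∃ e : Expr S α β, e.IsFC ∧ E.Simulates K e Q := by
  classical
  obtain ⟨τ₀, hbody, hhead⟩ := ht
  obtain ⟨τ, hτ, hatoms⟩ := hbody.exists_atomTyped hQ
  have hhead : S.ArgsTyped (α, β) k fun i => τ (Q.head i) := by
    have : (fun i => τ (Q.head i)) = fun i => τ₀ (Q.head i) :=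
      funext fun i => hτ _ (by simp [Q.free_body])
    rwa [this]
  have hatom : ∀ a ∈ Q.body.atoms, IsMatlang E τ a.vars
      (fun (P : E.Inputs K) ν => a.eval P.1.2 ν) := fun a ha => IsMatlang.atom (hatoms a ha)
  let X := Finset.univ.image Q.head
  have hXcard : X.card ≤ 2 := Finset.card_image_le.trans (by simpa using hk)
  have hX : Q.body.free = X := Q.free_body
  have hXatoms : X ⊆ atomsVars Q.body.atoms := hX ▸ Formula.IsPrenex.free_subset hQ
  have : Fintype {a : Atom σ // a ∈ Q.body.atoms} :=
    Fintype.subtype Q.body.atoms.toFinset (by simp)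
  let F : Option {a : Atom σ // a ∈ Q.body.atoms} → E.Inputs K → (ℕ → ℕ+) → K
    | none => fun P ν => if ∀ x ∈ X, ν x ≤ P.dims τ x then 1 else 0
    | some a => (fun P ν => a.1.eval P.1.2 ν) ^ Q.body.atoms.count a.1
  have hF : ∀ a ∈ Finset.univ, IsMatlang E τ (Q.atomVarsWithHead a) (F a) := by
    rintro (_ | a) -
    · exact IsMatlang.range E τ hXcard
    · exact (hatom a a.2).pow (Multiset.count_ne_zero.2 a.2)
  have key := IsMatlang.joinSet (hT.joinSet none) F hF
  have hprod : ∀ P, ∏ a, F a P = evalAtoms P.1.2 Q.body.atoms := by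
    intro P
    funext ν
    have h1 : evalAtoms P.1.2 Q.body.atoms ν = ∏ a, F (some a) P ν := by
      rw [evalAtoms, Finset.prod_multiset_map_count,
        Finset.prod_subtype Q.body.atoms.toFinset (p := (· ∈ Q.body.atoms)) (by simp)]
      rfl
    rw [Fintype.prod_option, Pi.mul_apply, Finset.prod_apply, ← h1]
    change (if ∀ x ∈ X, ν x ≤ P.dims τ x then 1 else 0) * _ = _
    split_ifs with h
    · rw [one_mul]
    · push Not at h
      obtain ⟨x, hx, hν⟩ := h
      obtain ⟨a, ha, hxa⟩ := mem_atomsVars.1 (hXatoms hx)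
      rw [zero_mul, evalAtoms_eq_zero ha ((hatom a ha).eq_zero hxa hν)]
  have hvars : Finset.univ.biUnion Q.atomVarsWithHead \ X
      = atomsVars Q.body.atoms \ Q.body.free := by
    rw [hX]
    ext z
    simp only [Finset.mem_sdiff, Finset.mem_biUnion, Finset.mem_univ, true_and, Option.exists,
      mem_atomsVars]
    refine and_congr_left fun hz => ⟨?_, ?_⟩
    · rintro (h | ⟨a, h⟩)
      · exact absurd h hz
      · exact ⟨a, a.2, h⟩
    · rintro ⟨a, ha, h⟩
      exact Or.inr ⟨⟨a, ha⟩, h⟩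
  have hbody' : IsMatlang E τ X fun (P : E.Inputs K) => Q.body.eval P.1.2 := by
    have : ∀ P : E.Inputs K, Q.body.eval P.1.2 =
        sumVars (P.dims τ) (Finset.univ.biUnion Q.atomVarsWithHead \ X) (∏ a, F a P) := by
      intro P
      rw [hprod, hvars]
      exact hQ.eval_eq _ _ fun a ha z hz ν hν => (hatom a ha).eq_zero hz hν
    simp only [this]
    exact key
  obtain ⟨e, he, h⟩ := IsMatlang.exists_expr hhead hbody'
    (R := fun P => Q.eval P.1.2) (fun P ν => Q.eval_comp_head P.1.2 ν)
    (fun P d i j hij hd => Q.eval_eq_zero P.1.2 hij hd)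
  exact ⟨e, he, fun I db hI => h ⟨(I, db), hI⟩⟩

/-! ### From expressions to free-connex conjunctive queries -/

section QueryTree

open scoped Classical

variable {K : Type w} [CommSemiring K] {S : MatSchema.{u}} {σ : Vocabulary.{v}}

/-- The variables of the atoms of a query, the head atom being `none`. -/
def headVars (X : Finset ℕ) : Option (Atom σ) → Finset ℕ
  | none => X
  | some a => a.vars

/-- The atoms of `L` as nodes of a join tree. -/
noncomputable def atomNodes (L : Multiset (Atom σ)) : Finset (Option (Atom σ)) :=
  L.toFinset.image some

lemma some_mem_atomNodes {L : Multiset (Atom σ)} {a : Atom σ} : some a ∈ atomNodes L ↔ a ∈ L := by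
  simp [atomNodes]

lemma none_notMem_atomNodes {L : Multiset (Atom σ)} : none ∉ atomNodes L := by
  simp [atomNodes]

/-- The conjunction of the typed atoms `L`, with the bound variables `b` and the free variables `X`,
has a join tree rooted at the head atom and computes `F`. It contains a comparison atom for every
free variable. -/
structure QueryTree (E : SchemaEncoding S σ) (τ : ℕ → S.Size) (X : Finset ℕ)
    (F : E.Inputs K → (ℕ → ℕ+) → K) (L : Multiset (Atom σ)) (b : Finset ℕ) : Prop where
  typed : ∀ a ∈ L, E.AtomTyped τ a
  vars : atomsVars L = X ∪ b
  disj : Disjoint b X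
  guard : ∀ x ∈ X, Atom.le x (E.size (τ x)) ∈ L
  join : JoinSet (headVars X) none (insert none (atomNodes L))
  eval : ∀ P : E.Inputs K, sumVars (P.dims τ) b (evalAtoms P.1.2 L) = F P

namespace QueryTree

variable {E : SchemaEncoding S σ} {τ : ℕ → S.Size} {X Y : Finset ℕ}
  {F G : E.Inputs K → (ℕ → ℕ+) → K} {L M : Multiset (Atom σ)} {b c : Finset ℕ}

lemma mem_vars (h : QueryTree E τ X F L b) {a : Atom σ} (ha : a ∈ L) {z : ℕ} (hz : z ∈ a.vars) :
    z ∈ X ∨ z ∈ b := by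
  rw [← Finset.mem_union, ← h.vars]
  exact mem_atomsVars.2 ⟨a, ha, hz⟩

/-- The conjunction of two queries with separate bound variables: their join trees are joined at
the head atom. -/
lemma mul (hF : QueryTree E τ X F L b) (hG : QueryTree E τ Y G M c) (hbY : Disjoint b Y)
    (hcX : Disjoint c X) (hbc : Disjoint b c) :
    QueryTree E τ (X ∪ Y) (F * G) (L + M) (b ∪ c) where
  typed a ha := (Multiset.mem_add.1 ha).elim (hF.typed a) (hG.typed a)
  vars := by
    have : atomsVars (L + M) = atomsVars L ∪ atomsVars M := by simp [atomsVars]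
    rw [this, hF.vars, hG.vars, Finset.union_union_union_comm]
  disj := by
    simp only [Finset.disjoint_union_left, Finset.disjoint_union_right]
    exact ⟨⟨hF.disj, hcX⟩, hbY, hG.disj⟩
  guard x hx := Multiset.mem_add.2 ((Finset.mem_union.1 hx).imp (hF.guard x) (hG.guard x))
  join := by
    have mem : ∀ {L : Multiset (Atom σ)} {a : Atom σ}, some a ∈ insert none (atomNodes L) → a ∈ L :=
      fun h => some_mem_atomNodes.1 ((Finset.mem_insert.1 h).resolve_left (by simp))
    have h1 := hF.join.transfer (vars' := headVars (X ∪ Y)) (r' := none) .root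
      (by
        rintro (_ | a) _ h
        · exact absurd rfl h
        · rfl)
      (by
        rintro (_ | a) ha h z hz ⟨p, hp, hzp⟩
        · exact absurd rfl h
        · rw [Finset.mem_singleton] at hp
          subst hp
          refine (hF.mem_vars (mem ha) hz).elim id fun hzb => ?_
          refine (Finset.mem_union.1 hzp).elim id fun hzY => ?_
          exact absurd hzY (Finset.disjoint_left.1 hbY hzb))
      (fun a _ _ => ⟨none, by simp, fun z _ hz => Finset.mem_union_left _ hz⟩)
    have h2 := hG.join.transfer h1
      (by
        rintro (_ | a) _ h
        · exact absurd rfl h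
        · rfl)
      (by
        rintro (_ | a) ha h z hz ⟨p, hp, hzp⟩
        · exact absurd rfl h
        · refine (hG.mem_vars (mem ha) hz).elim id fun hzc => ?_
          have hzb := Finset.disjoint_right.1 hbc hzc
          have hzX := Finset.disjoint_left.1 hcX hzc
          rcases p with _ | p
          · exact (Finset.mem_union.1 hzp).resolve_left hzX
          · have hp : p ∈ L := by simpa [atomNodes] using hp
            exact ((hF.mem_vars hp hzp).elim hzX hzb).elim)
      (fun a _ _ => ⟨none, by simp, fun z _ hz => Finset.mem_union_right _ hz⟩)
    convert h2 using 1
    ext (_ | a) <;> simp [atomNodes]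
  eval P := by
    have hprod : evalAtoms P.1.2 (L + M) = evalAtoms P.1.2 L * evalAtoms P.1.2 M := by
      funext ν; simp [evalAtoms]
    have h1 : IndepOf (evalAtoms P.1.2 L) c := evalAtoms_indepOf (by
      rw [hF.vars, Finset.disjoint_union_right]; exact ⟨hcX, hbc.symm⟩)
    have h2 : IndepOf (evalAtoms P.1.2 M) b := evalAtoms_indepOf (by
      rw [hG.vars, Finset.disjoint_union_right]; exact ⟨hbY, hbc⟩)
    rw [hprod, sumVars_union _ hbc, sumVars_mul_left _ h1, hG.eval P, sumVars_mul_right, hF.eval P]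
    · rfl
    · rw [← hG.eval P]
      exact sumVars_indepOf _ h2

lemma _root_.MatSchema.ArgsTyped.arity_le {t : S.Size × S.Size} :
    ∀ {k : ℕ} {s : Fin k → S.Size}, S.ArgsTyped t k s → k ≤ 2
  | 0, _, _ => by omega
  | 1, _, _ => by omega
  | 2, _, _ => le_rfl
  | _ + 3, _, h => h.elim

lemma _root_.SchemaEncoding.AtomTyped.card_vars_le {a : Atom σ} (h : E.AtomTyped τ a) :
    a.vars.card ≤ 2 := by
  cases a with
  | rel R args =>
    exact Finset.card_image_le.trans (by simpa using MatSchema.ArgsTyped.arity_le h)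
  | le x c => simp [Atom.vars]

/-- The head atom can be removed from a join tree if it has one or two variables. If some atom has
exactly the variables of the head, it takes the place of the head; otherwise no atom contains both
head variables, and the two comparison atoms take the place of the head. -/
lemma headless (h : QueryTree E τ X F L b) (hX : X.Nonempty) (hX2 : X.card ≤ 2) (Z : Finset ℕ) :
    ∃ r, JoinSet (headVars Z) r (atomNodes L) := by
  have of_base : ∀ {t : Finset (Option (Atom σ))} {r}, JoinSet (headVars Z) r t →
      t ⊆ atomNodes L → (∀ a ∈ t, headVars Z a ⊆ X) →
      (∀ a ∈ L, ∃ p ∈ t, ∀ z ∈ a.vars, z ∈ X → z ∈ headVars Z p) →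
      ∃ r, JoinSet (headVars Z) r (atomNodes L) := by
    intro t r ht htL htX hp
    refine ⟨r, ?_⟩
    have := h.join.transfer ht
      (by
        rintro (_ | a) _ h
        · exact absurd rfl h
        · rfl)
      (by
        rintro a ha _ z hz ⟨p, hp, hzp⟩
        exact htX p hp hzp)
      (by
        rintro (_ | a) ha h
        · exact absurd rfl h
        · exact hp a (some_mem_atomNodes.1 ((Finset.mem_insert.1 ha).resolve_left (by simp))))
    rw [Finset.erase_insert none_notMem_atomNodes, Finset.union_eq_right.2 htL] at this
    exact this
  by_cases hc : ∃ c ∈ L, c.vars = X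
  · obtain ⟨c, hcL, rfl⟩ := hc
    refine of_base (t := {some c}) .root ?_ ?_ fun a _ => ⟨some c, by simp, fun z _ hz => hz⟩
    · simpa using some_mem_atomNodes.2 hcL
    · intro a ha
      rw [Finset.mem_singleton.1 ha]
      exact subset_rfl
  · push Not at hc
    have hX1 : X.card ≠ 1 := by
      intro h1
      obtain ⟨x, rfl⟩ := Finset.card_eq_one.1 h1
      exact hc _ (h.guard x (by simp)) rfl
    have := hX.card_pos
    obtain ⟨x, y, hxy, rfl⟩ := Finset.card_eq_two.1 (show X.card = 2 by omega)
    have hgx := h.guard x (by simp)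
    have hgy := h.guard y (by simp)
    set gx := Atom.le x (E.size (τ x)) with hgx'
    set gy := Atom.le y (E.size (τ y)) with hgy'
    have hvx : headVars Z (some gx) = {x} := rfl
    have hvy : headVars Z (some gy) = {y} := rfl
    have base : JoinSet (headVars Z) (some gx) {some gy, some gx} :=
      JoinSet.root.insert (p := some gx) (by simp) (by
        rintro z hz ⟨p, hp, hzp⟩
        rwa [← Finset.mem_singleton.1 hp])
    refine of_base base ?_ ?_ ?_
    · simp [Finset.insert_subset_iff, some_mem_atomNodes, hgx, hgy]
    · intro a ha
      rw [Finset.mem_insert, Finset.mem_singleton] at ha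
      rcases ha with rfl | rfl
      · rw [hvy]; simp
      · rw [hvx]; simp
    · intro a ha
      have hne : ¬ (x ∈ a.vars ∧ y ∈ a.vars) := fun ⟨h1, h2⟩ => hc a ha (Eq.symm (by
        refine Finset.eq_of_subset_of_card_le ?_ ?_
        · simp [Finset.insert_subset_iff, h1, h2]
        · rw [Finset.card_pair hxy]
          exact (h.typed a ha).card_vars_le))
      by_cases hx : x ∈ a.vars
      · refine ⟨some gx, by simp, fun z hz hzX => ?_⟩
        rw [hvx]
        grind
      · refine ⟨some gy, by simp, fun z hz hzX => ?_⟩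
        rw [hvy]
        grind

/-- Quantification over one of at most two free variables. -/
lemma sumVar (h : QueryTree E τ X F L b) {x : ℕ} (hx : x ∈ X) (hX2 : X.card ≤ 2) :
    QueryTree E τ (X.erase x) (fun P => sumVar (P.dims τ) x (F P)) L (insert x b) where
  typed := h.typed
  vars := by
    rw [h.vars]
    ext z
    simp only [Finset.mem_union, Finset.mem_erase, Finset.mem_insert]
    grind
  disj := by
    rw [Finset.disjoint_insert_left]
    exact ⟨by simp, h.disj.mono_right (Finset.erase_subset _ _)⟩
  guard y hy := h.guard y (Finset.mem_of_mem_erase hy)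
  join := by
    obtain ⟨r, hr⟩ := h.headless ⟨x, hx⟩ hX2 (X.erase x)
    have hcard : (X.erase x).card ≤ 1 := by
      rw [Finset.card_erase_of_mem hx]; omega
    refine JoinSet.reroot (r := r) ?_ (Finset.mem_insert_self _ _)
    rcases (X.erase x).eq_empty_or_nonempty with h0 | ⟨y, hy⟩
    · refine hr.insert hr.root_mem fun z hz _ => ?_
      change z ∈ X.erase x at hz
      simp [h0] at hz
    · refine hr.insert (p := some (Atom.le y (E.size (τ y))))
        (some_mem_atomNodes.2 (h.guard y (Finset.mem_of_mem_erase hy))) fun z hz _ => ?_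
      rw [Finset.card_le_one.1 hcard z hz y hy]
      simp [headVars, Atom.vars]
  eval P := by
    rw [sumVars_insert _ (Finset.disjoint_right.1 h.disj hx), h.eval P]

/-- The conjunctive query presented by a join tree. -/
lemma exists_query (h : QueryTree E τ X F L b) (hL : ∃ r, JoinSet (headVars X) r (atomNodes L))
    {k : ℕ} (hk : k ≤ 2) {head : Fin k → ℕ} (hX : X = Finset.univ.image head) :
    ∃ Q : Query σ k, Q.head = head ∧ Q.IsBinary ∧ Q.IsCQ ∧ Q.IsFreeConnex ∧ E.Typed Q.body τ ∧
      ∀ P : E.Inputs K, Q.body.eval P.1.2 = F P := by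
  obtain ⟨r, hr⟩ := hL
  have hne : L ≠ 0 := by
    rintro rfl
    have := hr.root_mem
    simp [atomNodes] at this
  have conj : ∃ φ : Formula σ, φ.IsAtomConj ∧ φ.atoms = L ∧ E.Typed φ τ := by
    have ht := h.typed
    clear * - hne ht
    induction L using Multiset.induction_on with
    | empty => exact absurd rfl hne
    | cons a L ih =>
      by_cases hL : L = 0
      · subst hL
        exact ⟨.atom a, trivial, rfl, ht a (by simp)⟩
      · obtain ⟨φ, h1, h2, h3⟩ := ih hL fun a ha => ht a (Multiset.mem_cons_of_mem ha)
        refine ⟨.and (.atom a) φ, ⟨trivial, h1⟩, ?_, ht a (by simp), h3⟩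
        rw [Formula.atoms, h2]
        rfl
  have prenex : ∃ φ : Formula σ, φ.IsPrenex ∧ φ.atoms = L ∧ E.Typed φ τ ∧
      φ.free = atomsVars L \ b := by
    obtain ⟨φ, h1, h2, h3⟩ := conj
    clear * - h1 h2 h3
    induction b using Finset.induction_on with
    | empty => exact ⟨φ, h1.isPrenex, h2, h3, by rw [h1.free_eq, h2, Finset.sdiff_empty]⟩
    | insert y b _ ih =>
      obtain ⟨ψ, h1, h2, h3, h4⟩ := ih
      refine ⟨.ex y ψ, h1, h2, ⟨τ y, by rwa [Function.update_eq_self]⟩, ?_⟩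
      rw [Formula.free, h4, Finset.sdiff_insert]
  obtain ⟨φ, hφ, hatoms, hφτ, hfree⟩ := prenex
  have hfree : φ.free = X := by
    rw [hfree, h.vars, Finset.union_sdiff_cancel_right h.disj.symm]
  have htyped : ∀ a ∈ φ.atoms, E.AtomTyped τ a := by rw [hatoms]; exact h.typed
  refine ⟨⟨head, φ, hfree.trans hX⟩, rfl, ⟨hk, fun R args ha => ?_⟩, hφ, ⟨?_, ?_⟩, hφτ, fun P => ?_⟩
  · exact MatSchema.ArgsTyped.arity_le (htyped _ ha)
  · refine hr.hasJoinTree (f := fun a => some a.1) ?_ ?_ (fun _ => rfl)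
    · exact (Option.some_injective _).comp Subtype.val_injective
    · rintro (_ | a)
      · simp [none_notMem_atomNodes]
      · simp [some_mem_atomNodes, hatoms]
  · refine h.join.hasJoinTree (f := Option.map Subtype.val)
      (Option.map_injective Subtype.val_injective) ?_ ?_
    · rintro (_ | a)
      · simp only [Finset.mem_insert_self, true_iff]
        exact ⟨none, rfl⟩
      · simp [some_mem_atomNodes, hatoms, Option.exists]
    · rintro (_ | a)
      · exact hX.symm
      · rfl
  · have hN : ∀ a ∈ φ.atoms, ∀ z ∈ a.vars, ∀ ν : ℕ → ℕ+, P.dims τ z < ν z → a.eval P.1.2 ν = 0 :=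
      fun a ha z hz ν hν => (IsMatlang.atom (K := K) (htyped a ha)).eq_zero hz hν
    rw [hφ.eval_eq P.1.2 (P.dims τ) hN, hfree, hatoms, h.vars,
      Finset.union_sdiff_cancel_left h.disj.symm, h.eval P]

end QueryTree

/-- `F`, a function of the variables in `X`, is computed by a query with a join tree rooted at its
head atom, and with bound variables that may be chosen outside of any given finite set. -/
def IsTreeQuery (E : SchemaEncoding S σ) (τ : ℕ → S.Size) (X : Finset ℕ)
    (F : E.Inputs K → (ℕ → ℕ+) → K) : Prop :=
  ∀ B : Finset ℕ, ∃ L b, Disjoint b B ∧ QueryTree E τ X F L b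

namespace IsTreeQuery

variable {E : SchemaEncoding S σ} {τ : ℕ → S.Size} {X Y : Finset ℕ}
  {F G : E.Inputs K → (ℕ → ℕ+) → K}

lemma of_eq (h : IsTreeQuery E τ X F) (hFG : ∀ P ν, F P ν = G P ν) : IsTreeQuery E τ X G :=
  (funext fun P => funext fun ν => hFG P ν : F = G) ▸ h

lemma mul (hF : IsTreeQuery E τ X F) (hG : IsTreeQuery E τ Y G) :
    IsTreeQuery E τ (X ∪ Y) (F * G) := by
  intro B
  obtain ⟨L, b, hb, hL⟩ := hF (B ∪ Y)
  obtain ⟨M, c, hc, hM⟩ := hG (B ∪ (X ∪ b))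
  simp only [Finset.disjoint_union_right] at hb hc
  refine ⟨L + M, b ∪ c, ?_, hL.mul hM hb.2 hc.2.1 hc.2.2.symm⟩
  rw [Finset.disjoint_union_left]
  exact ⟨hb.1, hc.1⟩

/-- Quantification over a variable, which is required to be fresh since it becomes bound. -/
lemma exists_fresh (hX : X.card ≤ 1) (h : ∀ B : Finset ℕ, ∃ x F, x ∉ B ∧
      IsTreeQuery E τ (insert x X) F ∧ ∀ P ν, sumVar (P.dims τ) x (F P) ν = G P ν) :
    IsTreeQuery E τ X G := by
  intro B
  obtain ⟨x, F, hx, hF, hFG⟩ := h (B ∪ X)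
  rw [Finset.mem_union, not_or] at hx
  obtain ⟨L, b, hb, hL⟩ := hF B
  refine ⟨L, insert x b, Finset.disjoint_insert_left.2 ⟨hx.1, hb⟩, ?_⟩
  have := hL.sumVar (Finset.mem_insert_self x X)
    ((Finset.card_insert_le _ _).trans (Nat.succ_le_succ hX))
  rw [Finset.erase_insert hx.2] at this
  exact (funext fun P => funext (hFG P) : (fun P => _root_.sumVar (P.dims τ) x (F P)) = G) ▸ this

/-- A typed atom, together with comparison atoms for its variables, which do not change its
value. -/
lemma atom {a : Atom σ} (ha : E.AtomTyped τ a) :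
    IsTreeQuery E τ a.vars (fun (P : E.Inputs K) ν => a.eval P.1.2 ν) := by
  intro B
  let guards := a.vars.val.map fun z => Atom.le z (E.size (τ z))
  have hg : ∀ g ∈ guards, ∃ z ∈ a.vars, g = Atom.le z (E.size (τ z)) := by
    intro g hg
    obtain ⟨z, hz, rfl⟩ := Multiset.mem_map.1 hg
    exact ⟨z, hz, rfl⟩
  refine ⟨a ::ₘ guards, ∅, Finset.disjoint_empty_left _, ?_, ?_, Finset.disjoint_empty_left _,
    ?_, ?_, ?_⟩
  · intro b hb
    rcases Multiset.mem_cons.1 hb with rfl | hb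
    · exact ha
    · obtain ⟨z, -, rfl⟩ := hg b hb
      simp [SchemaEncoding.AtomTyped]
  · ext z
    rw [mem_atomsVars, Finset.union_empty]
    constructor
    · rintro ⟨b, hb, hz⟩
      rcases Multiset.mem_cons.1 hb with rfl | hb
      · exact hz
      · obtain ⟨y, hy, rfl⟩ := hg b hb
        rw [Atom.vars, Finset.mem_singleton] at hz
        rwa [hz]
    · exact fun hz => ⟨a, Multiset.mem_cons_self _ _, hz⟩
  · exact fun x hx => Multiset.mem_cons_of_mem (Multiset.mem_map.2 ⟨x, hx, rfl⟩)
  · -- every atom hangs below the head atom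
    have star : ∀ s : Finset (Option (Atom σ)), (∀ b ∈ s, headVars a.vars b ⊆ a.vars) →
        JoinSet (headVars a.vars) none (insert none s) := by
      intro s
      induction s using Finset.induction_on with
      | empty => exact fun _ => .root
      | insert b s _ ih =>
        intro hs
        rw [Finset.insert_comm]
        exact (ih fun c hc => hs c (Finset.mem_insert_of_mem hc)).insert (p := none) (by simp)
          fun z hz _ => hs b (Finset.mem_insert_self _ _) hz
    refine star _ ?_
    rintro (_ | b) hb
    · exact absurd hb none_notMem_atomNodes
    · rcases Multiset.mem_cons.1 (some_mem_atomNodes.1 hb) with rfl | hb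
      · exact subset_rfl
      · obtain ⟨z, hz, rfl⟩ := hg b hb
        simpa [headVars, Atom.vars] using hz
  · intro P
    funext ν
    have hdim : ∀ z, P.1.2.const (E.size (τ z)) = P.dims τ z := fun z => P.2.2 (τ z)
    rw [sumVars_empty]
    by_cases hν : ∀ z ∈ a.vars, ν z ≤ P.dims τ z
    · have : evalAtoms P.1.2 guards ν = 1 := by
        refine Multiset.prod_eq_one fun k hk => ?_
        obtain ⟨b, hb, rfl⟩ := Multiset.mem_map.1 hk
        obtain ⟨z, hz, rfl⟩ := hg b hb
        rw [Atom.eval, hdim, if_pos (hν z hz)]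
      rw [evalAtoms] at this
      rw [evalAtoms, Multiset.map_cons, Multiset.prod_cons, this, mul_one]
    · push Not at hν
      obtain ⟨z, hz, hν⟩ := hν
      have h0 := (IsMatlang.atom (K := K) ha).eq_zero hz hν
      rw [evalAtoms_eq_zero (Multiset.mem_cons_self _ _) h0, h0]

lemma range (x : ℕ) : IsTreeQuery E τ {x}
    (fun (P : E.Inputs K) ν => if ν x ≤ P.dims τ x then 1 else 0) := by
  refine (atom (a := Atom.le x (E.size (τ x))) ?_).of_eq fun P ν => ?_
  · simp [SchemaEncoding.AtomTyped]
  · simp only [Atom.eval]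
    rw [P.2.2 (τ x)]
    rfl

end IsTreeQuery

end QueryTree

/-! ### The operations of fc-MATLANG on conjunctive queries -/

section MatrixQuery

open scoped Classical

variable {K : Type w} [CommSemiring K] {S : MatSchema.{u}} {σ : Vocabulary.{v}}

/-- The matrices `f P`, of type `(α, β)` and extended by zero, are computed by queries with join
trees: their diagonals by queries with one head variable, and the matrices themselves by queries
with two different head variables unless they are diagonal matrices. -/
structure IsMatrixQuery (E : SchemaEncoding S σ) (τ : ℕ → S.Size) (α β : S.Size)
    (f : E.Inputs K → ℕ+ → ℕ+ → K) : Prop where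
  supp : ∀ P i j, P.1.1.dim α < i ∨ P.1.1.dim β < j → f P i j = 0
  diag : ∀ x, τ x = α → τ x = β → IsTreeQuery E τ {x} fun P ν => f P (ν x) (ν x)
  pair : (∀ x y, x ≠ y → τ x = α → τ y = β →
      IsTreeQuery E τ {x, y} fun P ν => f P (ν x) (ν y)) ∨
    (α = β ∧ ∀ P i j, i ≠ j → f P i j = 0)

namespace IsMatrixQuery

variable {E : SchemaEncoding S σ} {τ : ℕ → S.Size} {α β γ : S.Size}
  {f g : E.Inputs K → ℕ+ → ℕ+ → K}

lemma of_eq (h : IsMatrixQuery E τ α β f) (hfg : ∀ P i j, f P i j = g P i j) :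
    IsMatrixQuery E τ α β g :=
  (funext fun P => funext fun i => funext fun j => hfg P i j : f = g) ▸ h

lemma transpose (h : IsMatrixQuery E τ α β f) :
    IsMatrixQuery E τ β α fun P i j => f P j i where
  supp P i j hij := h.supp P j i hij.symm
  diag x hα hβ := h.diag x hβ hα
  pair := h.pair.imp
    (fun h x y hxy hx hy => by rw [Finset.pair_comm]; exact h y x hxy.symm hy hx)
    (fun h => ⟨h.1.symm, fun P i j hij => h.2 P j i hij.symm⟩)

lemma eq_one_of_le {P : E.Inputs K} {d : ℕ+} (h : d ≤ P.1.1.dim S.one) : d = 1 := by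
  rw [P.1.1.dim_one] at h
  exact le_antisymm h one_le

/-- The sum over a variable of type `1` has only one term. -/
lemma sumVar_one {P : E.Inputs K} {x : ℕ} (hx : τ x = S.one) (F : (ℕ → ℕ+) → K) (ν : ℕ → ℕ+) :
    sumVar (P.dims τ) x F ν = F (Function.update ν x 1) := by
  rw [sumVar, SchemaEncoding.Inputs.dims, hx, P.1.1.dim_one, Finset.Icc_self,
    Finset.sum_singleton]

lemma col (hτ : ∀ (α : S.Size) (B : Finset ℕ), ∃ x ∉ B, τ x = α)
    (h : IsMatrixQuery E τ α S.one f) {x : ℕ} (hx : τ x = α) :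
    IsTreeQuery E τ {x} fun P ν => f P (ν x) 1 := by
  rcases h.pair with hp | ⟨hα, -⟩
  · refine IsTreeQuery.exists_fresh (by simp) fun B => ?_
    obtain ⟨y, hy, hτy⟩ := hτ S.one (insert x B)
    rw [Finset.mem_insert, not_or] at hy
    refine ⟨y, _, hy.2, Finset.pair_comm x y ▸ hp x y (Ne.symm hy.1) hx hτy, fun P ν => ?_⟩
    rw [sumVar_one hτy, Function.update_self, Function.update_of_ne (Ne.symm hy.1)]
  · refine (h.diag x hx (hx.trans hα)).of_eq fun P ν => ?_
    by_cases hν : ν x ≤ P.1.1.dim S.one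
    · rw [eq_one_of_le hν]
    · rw [h.supp P _ _ (Or.inr (not_le.1 hν)), h.supp P _ _ (Or.inl (hα ▸ not_le.1 hν))]

lemma row (hτ : ∀ (α : S.Size) (B : Finset ℕ), ∃ x ∉ B, τ x = α)
    (h : IsMatrixQuery E τ S.one β f) {x : ℕ} (hx : τ x = β) :
    IsTreeQuery E τ {x} fun P ν => f P 1 (ν x) :=
  h.transpose.col hτ hx

lemma scalar (hτ : ∀ (α : S.Size) (B : Finset ℕ), ∃ x ∉ B, τ x = α)
    (h : IsMatrixQuery E τ S.one S.one f) :
    IsTreeQuery E τ ∅ fun P _ => f P 1 1 := by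
  refine IsTreeQuery.exists_fresh (by simp) fun B => ?_
  obtain ⟨x, hx, hτx⟩ := hτ S.one B
  refine ⟨x, _, hx, h.col hτ hτx, fun P ν => ?_⟩
  rw [sumVar_one hτx, Function.update_self]

/-- A matrix of type `(α, 1)` is determined by its only column. -/
lemma of_col (hsupp : ∀ P i j, P.1.1.dim α < i ∨ P.1.1.dim S.one < j → f P i j = 0)
    (h : ∀ x, τ x = α → IsTreeQuery E τ {x} fun P ν => f P (ν x) 1) :
    IsMatrixQuery E τ α S.one f := by
  have eq : ∀ {y} (P : E.Inputs K) (i : ℕ+) (ν : ℕ → ℕ+), τ y = S.one →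
      f P i 1 * (if ν y ≤ P.dims τ y then 1 else 0) = f P i (ν y) := by
    intro y P i ν hy
    rw [SchemaEncoding.Inputs.dims, hy]
    split_ifs with hν
    · rw [eq_one_of_le hν, mul_one]
    · rw [hsupp P _ _ (Or.inr (not_le.1 hν)), mul_zero]
  refine ⟨hsupp, fun x hx hx' => ?_, Or.inl fun x y _ hx hy => ?_⟩
  · have := (h x hx).mul (IsTreeQuery.range (E := E) (τ := τ) x)
    rw [Finset.union_self] at this
    exact this.of_eq fun P ν => eq P (ν x) ν hx'
  · exact ((h x hx).mul (IsTreeQuery.range (E := E) (τ := τ) y)).of_eq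
      fun P ν => eq P (ν x) ν hy

lemma of_scalar (hsupp : ∀ P i j, P.1.1.dim S.one < i ∨ P.1.1.dim S.one < j → f P i j = 0)
    (h : IsTreeQuery E τ ∅ fun P _ => f P 1 1) : IsMatrixQuery E τ S.one S.one f := by
  refine of_col hsupp fun x hx => ?_
  have := h.mul (IsTreeQuery.range (E := E) (τ := τ) x)
  rw [Finset.empty_union] at this
  refine this.of_eq fun P ν => ?_
  simp only [Pi.mul_apply]
  rw [SchemaEncoding.Inputs.dims, hx]
  split_ifs with hν
  · rw [eq_one_of_le hν, mul_one]
  · rw [hsupp P _ _ (Or.inl (not_le.1 hν)), mul_zero]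

lemma hadamard (hf : IsMatrixQuery E τ α β f) (hg : IsMatrixQuery E τ α β g) :
    IsMatrixQuery E τ α β fun P i j => f P i j * g P i j where
  supp P i j h := by rw [hf.supp P i j h, zero_mul]
  diag x hx hx' := by
    have := (hf.diag x hx hx').mul (hg.diag x hx hx')
    rw [Finset.union_self] at this
    exact this
  pair := by
    rcases hf.pair with hf | ⟨h, hf⟩
    · rcases hg.pair with hg | ⟨h, hg⟩
      · refine Or.inl fun x y hxy hx hy => ?_
        have := (hf x y hxy hx hy).mul (hg x y hxy hx hy)
        rw [Finset.union_self] at this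
        exact this
      · exact Or.inr ⟨h, fun P i j hij => by rw [hg P i j hij, mul_zero]⟩
    · exact Or.inr ⟨h, fun P i j hij => by rw [hf P i j hij, zero_mul]⟩

lemma smul (hτ : ∀ (α : S.Size) (B : Finset ℕ), ∃ x ∉ B, τ x = α)
    (hf : IsMatrixQuery E τ S.one S.one f) (hg : IsMatrixQuery E τ α β g) :
    IsMatrixQuery E τ α β fun P i j => f P 1 1 * g P i j where
  supp P i j h := by rw [hg.supp P i j h, mul_zero]
  diag x hx hx' := by
    have := (hf.scalar hτ).mul (hg.diag x hx hx')
    rw [Finset.empty_union] at this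
    exact this
  pair := hg.pair.imp
    (fun h x y hxy hx hy => by
      have := (hf.scalar hτ).mul (h x y hxy hx hy)
      rw [Finset.empty_union] at this
      exact this)
    (fun h => ⟨h.1, fun P i j hij => by rw [h.2 P i j hij, mul_zero]⟩)

/-- The product of a matrix and a column vector. -/
lemma mul_col (hτ : ∀ (α : S.Size) (B : Finset ℕ), ∃ x ∉ B, τ x = α)
    (hf : IsMatrixQuery E τ α β f) (hg : IsMatrixQuery E τ β S.one g) :
    IsMatrixQuery E τ α S.one
      fun P i j => ∑ d ∈ Finset.Icc 1 (P.1.1.dim β), f P i d * g P d j := by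
  refine of_col (fun P i j h => Finset.sum_eq_zero fun d _ => ?_) fun x hx => ?_
  · rcases h with h | h
    · rw [hf.supp P i d (Or.inl h), zero_mul]
    · rw [hg.supp P d j (Or.inr h), mul_zero]
  rcases hf.pair with hp | ⟨rfl, hp⟩
  · refine IsTreeQuery.exists_fresh (by simp) fun B => ?_
    obtain ⟨y, hy, hτy⟩ := hτ β (insert x B)
    rw [Finset.mem_insert, not_or] at hy
    have := (hp x y (Ne.symm hy.1) hx hτy).mul (hg.col hτ hτy)
    rw [Finset.union_eq_left.2 (by simp), Finset.pair_comm] at this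
    refine ⟨y, _, hy.2, this, fun P ν => ?_⟩
    simp only [sumVar, SchemaEncoding.Inputs.dims, hτy, Pi.mul_apply, Function.update_self,
      Function.update_of_ne (Ne.symm hy.1)]
  · have := (hf.diag x hx hx).mul (hg.col hτ hx)
    rw [Finset.union_self] at this
    refine this.of_eq fun P ν => ?_
    by_cases hν : ν x ≤ P.1.1.dim α
    · rw [Finset.sum_eq_single (ν x)]
      · rfl
      · intro d _ hd
        rw [hp P _ _ (Ne.symm hd), zero_mul]
      · exact fun h => absurd (Finset.mem_Icc.2 ⟨one_le, hν⟩) h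
    · simp only [Pi.mul_apply]
      rw [hf.supp P _ _ (Or.inl (not_le.1 hν)), zero_mul]
      exact (Finset.sum_eq_zero fun d _ => by
        rw [hf.supp P _ _ (Or.inl (not_le.1 hν)), zero_mul]).symm

/-- The product of a row vector and a matrix. -/
lemma row_mul (hτ : ∀ (α : S.Size) (B : Finset ℕ), ∃ x ∉ B, τ x = α)
    (hf : IsMatrixQuery E τ S.one β f) (hg : IsMatrixQuery E τ β γ g) :
    IsMatrixQuery E τ S.one γ
      fun P i j => ∑ d ∈ Finset.Icc 1 (P.1.1.dim β), f P i d * g P d j :=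
  (mul_col hτ hg.transpose hf.transpose).transpose.of_eq fun _ _ _ =>
    Finset.sum_congr rfl fun _ _ => mul_comm _ _

/-- The product of a column vector and a row vector. -/
lemma col_mul_row (hτ : ∀ (α : S.Size) (B : Finset ℕ), ∃ x ∉ B, τ x = α)
    (hf : IsMatrixQuery E τ α S.one f) (hg : IsMatrixQuery E τ S.one γ g) :
    IsMatrixQuery E τ α γ
      fun P i j => ∑ d ∈ Finset.Icc 1 (P.1.1.dim S.one), f P i d * g P d j := by
  have eq : ∀ (P : E.Inputs K) i j, ∑ d ∈ Finset.Icc 1 (P.1.1.dim S.one), f P i d * g P d j =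
      f P i 1 * g P 1 j := fun P i j => by
    rw [P.1.1.dim_one, Finset.Icc_self, Finset.sum_singleton]
  simp only [eq]
  refine ⟨fun P i j h => ?_, fun x hx hx' => ?_, Or.inl fun x y _ hx hy => ?_⟩
  · rcases h with h | h
    · rw [hf.supp P i 1 (Or.inl h), zero_mul]
    · rw [hg.supp P 1 j (Or.inr h), mul_zero]
  · have := (hf.col hτ hx).mul (hg.row hτ hx')
    rw [Finset.union_self] at this
    exact this
  · exact (hf.col hτ hx).mul (hg.row hτ hy)

lemma ones (α : S.Size) : IsMatrixQuery E τ α S.one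
    fun (P : E.Inputs K) i j => (Expr.ones α).val P.1.1 i j := by
  refine of_col (fun P i j h => Expr.val_eq_zero _ _ h) fun x hx => ?_
  refine (IsTreeQuery.range x).of_eq fun P ν => ?_
  rw [Expr.val_ones, SchemaEncoding.Inputs.dims, hx]
  simp

lemma ident (α : S.Size) : IsMatrixQuery E τ α α
    fun (P : E.Inputs K) i j => (Expr.ident α).val P.1.1 i j := by
  refine ⟨fun P i j h => Expr.val_eq_zero _ _ h, fun x hx _ => ?_,
    Or.inr ⟨rfl, fun P i j hij => ?_⟩⟩
  · refine (IsTreeQuery.range x).of_eq fun P ν => ?_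
    rw [Expr.val_ident, SchemaEncoding.Inputs.dims, hx]
    simp
  · rw [Expr.val_ident, if_neg fun h => hij h.1]

/-- The matrix encoded by a relation `R` whose typed atoms are computed by queries. -/
lemma of_relation {t : S.Size × S.Size} {e : Expr S t.1 t.2} {k : ℕ} (hk : S.Encodable t k)
    {R : E.Inputs K → (Fin k → ℕ+) → K}
    (hR : ∀ P : E.Inputs K, EncodesMatrix (e.eval P.1.1) k (R P))
    (hQ : ∀ args : Fin k → ℕ, (S.ArgsTyped t k fun i => τ (args i)) →
      IsTreeQuery E τ (Finset.univ.image args) fun (P : E.Inputs K) ν => R P fun i => ν (args i)) :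
    IsMatrixQuery E τ t.1 t.2 fun (P : E.Inputs K) i j => e.val P.1.1 i j := by
  obtain ⟨α, β⟩ := t
  have one : ∀ P : E.Inputs K, (P.1.1.dim S.one : ℕ) = 1 := fun P => by rw [P.1.1.dim_one]; rfl
  have hsupp : ∀ (P : E.Inputs K) i j, P.1.1.dim α < i ∨ P.1.1.dim β < j → e.val P.1.1 i j = 0 :=
    fun P i j h => Expr.val_eq_zero _ _ h
  have hconst : ∀ (x : ℕ) (ν : ℕ → ℕ+), (fun i : Fin 1 => ν (![x] i)) = ![ν x] := fun x ν => by
    funext i; rw [Subsingleton.elim i 0]; rfl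
  rcases hk with rfl | ⟨rfl, hk⟩ | ⟨rfl, hk⟩
  · have hpair : ∀ x y, τ x = α → τ y = β →
        IsTreeQuery E τ {x, y} fun (P : E.Inputs K) ν => e.val P.1.1 (ν x) (ν y) := by
      rintro x y rfl rfl
      have := hQ ![x, y] rfl
      rw [show Finset.univ.image ![x, y] = {x, y} by ext z; simp [eq_comm, Fin.exists_fin_two]]
        at this
      refine this.of_eq fun P ν => ?_
      rw [show (fun i => ν (![x, y] i)) = ![ν x, ν y] by funext i; fin_cases i <;> rfl]
      exact encodesMatrix_two.1 (hR P) _ _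
    exact ⟨hsupp, fun x hx hx' => by simpa using hpair x x hx hx',
      Or.inl fun x y _ => hpair x y⟩
  · rcases hk with hk | hk
    · obtain rfl : α = S.one := hk
      refine (of_col (f := fun P i j => e.val P.1.1 j i) (fun P i j h => hsupp P j i h.symm)
        fun x hx => ?_).transpose
      have := hQ ![x] (Or.inr (Prod.ext rfl hx.symm))
      rw [show Finset.univ.image ![x] = {x} by simp] at this
      refine this.of_eq fun P ν => ?_
      rw [hconst]
      exact (encodesMatrix_row (one P)).1 (hR P) _
    · obtain rfl : β = S.one := hk
      refine of_col hsupp fun x hx => ?_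
      have := hQ ![x] (Or.inl (Prod.ext hx.symm rfl))
      rw [show Finset.univ.image ![x] = {x} by simp] at this
      refine this.of_eq fun P ν => ?_
      rw [hconst]
      exact (encodesMatrix_col (one P)).1 (hR P) _
  · obtain ⟨rfl, rfl⟩ := Prod.mk.inj hk
    refine of_scalar hsupp ?_
    have := hQ ![] rfl
    rw [show Finset.univ.image (![] : Fin 0 → ℕ) = ∅ by simp] at this
    refine this.of_eq fun P ν => ?_
    rw [Subsingleton.elim (fun i => ν (![] i)) ![]]
    exact (encodesMatrix_zero (one P) (one P)).1 (hR P)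

lemma sym (A : S.Mat) : IsMatrixQuery E τ (S.ty A).1 (S.ty A).2
    fun (P : E.Inputs K) i j => (Expr.sym A).val P.1.1 i j := by
  refine of_relation (E.encodable A) (fun P => P.2.1 A) fun args h => ?_
  refine IsTreeQuery.atom (a := Atom.rel (E.mat A) args) ?_
  simpa [SchemaEncoding.AtomTyped] using h

/-- Every fc-MATLANG expression is computed by queries with join trees. -/
theorem of_isFC (hτ : ∀ (α : S.Size) (B : Finset ℕ), ∃ x ∉ B, τ x = α) (e : Expr S α β)
    (he : e.IsFC) : IsMatrixQuery E τ α β fun (P : E.Inputs K) i j => e.val P.1.1 i j := by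
  induction e with
  | sym A => exact sym A
  | transpose e ih => exact (ih he).transpose.of_eq fun P i j => (Expr.val_transpose _ _ _ e).symm
  | mul e₁ e₂ ih₁ ih₂ =>
    obtain ⟨he₁, he₂, ht⟩ := he
    simp only [Expr.val_mul]
    rcases ht with (rfl | rfl) | (rfl | rfl)
    · exact row_mul hτ (ih₁ he₁) (ih₂ he₂)
    · exact col_mul_row hτ (ih₁ he₁) (ih₂ he₂)
    · exact col_mul_row hτ (ih₁ he₁) (ih₂ he₂)
    · exact mul_col hτ (ih₁ he₁) (ih₂ he₂)
  | add => exact he.elim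
  | smul e₁ e₂ ih₁ ih₂ =>
    simp only [Expr.val_smul]
    exact smul hτ (ih₁ he.1) (ih₂ he.2)
  | hadamard e₁ e₂ ih₁ ih₂ =>
    simp only [Expr.val_hadamard]
    exact hadamard (ih₁ he.1) (ih₂ he.2)
  | ones α => exact ones α
  | ident α => exact ident α

end IsMatrixQuery

/-- Every fc-MATLANG expression is equivalent to a binary free-connex conjunctive query. -/
theorem exists_query_of_expr {E : SchemaEncoding S σ} {α β : S.Size} {e : Expr S α β} {k : ℕ}
    (he : e.IsFC) (hk : S.Encodable (α, β) k) :
    ∃ Q : Query σ k, (Q.IsBinary ∧ Q.IsCQ ∧ Q.IsFreeConnex) ∧ E.QueryTyped (α, β) Q ∧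
      E.Simulates K e Q := by
  -- a typing of the variables with infinitely many variables of each size
  obtain ⟨τ, hτ⟩ : ∃ τ : ℕ → S.Size, ∀ (α : S.Size) (B : Finset ℕ), ∃ x ∉ B, τ x = α := by
    have := S.finite_size
    have : Nonempty S.Size := ⟨S.one⟩
    obtain ⟨g, hg⟩ := exists_surjective_nat S.Size
    refine ⟨fun n => g n.unpair.2, fun α B => ?_⟩
    obtain ⟨c, rfl⟩ := hg α
    have hinj : Function.Injective fun n => Nat.pair n c := fun m n h => (Nat.pair_eq_pair.1 h).1
    obtain ⟨x, ⟨n, rfl⟩, hx⟩ := (Set.infinite_range_of_injective hinj).exists_notMem_finset B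
    exact ⟨_, hx, by simp⟩
  have hM : IsMatrixQuery E τ α β fun (P : E.Inputs K) i j => e.val P.1.1 i j :=
    IsMatrixQuery.of_isFC hτ e he
  have one : ∀ P : E.Inputs K, (P.1.1.dim S.one : ℕ) = 1 := fun P => by rw [P.1.1.dim_one]; rfl
  have fin : ∀ {X : Finset ℕ} {F : E.Inputs K → (ℕ → ℕ+) → K}, IsTreeQuery E τ X F → X.Nonempty →
      ∀ {k : ℕ}, k ≤ 2 → ∀ {head : Fin k → ℕ}, X = Finset.univ.image head →
      ∃ Q : Query σ k, Q.head = head ∧ Q.IsBinary ∧ Q.IsCQ ∧ Q.IsFreeConnex ∧ E.Typed Q.body τ ∧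
      ∀ P : E.Inputs K, Q.body.eval P.1.2 = F P := by
    intro X F h hX k hk head hhead
    obtain ⟨L, b, -, hL⟩ := h ∅
    have hcard : X.card ≤ 2 := hhead ▸ Finset.card_image_le.trans (by simpa using hk)
    exact hL.exists_query (hL.headless hX hcard X) hk hhead
  rcases hk with rfl | ⟨rfl, hk⟩ | ⟨rfl, hk⟩
  · rcases hM.pair with hp | ⟨rfl, hp⟩
    · obtain ⟨x, -, hx⟩ := hτ α ∅
      obtain ⟨y, hy, hy'⟩ := hτ β {x}
      have hxy : x ≠ y := fun h => hy (by simp [h])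
      obtain ⟨Q, hh, h1, h2, h3, h4, h5⟩ := fin (hp x y hxy hx hy') (by simp) le_rfl
        (head := ![x, y]) (by ext z; simp [eq_comm, Fin.exists_fin_two])
      refine ⟨Q, ⟨h1, h2, h3⟩, ⟨τ, h4, ?_⟩, fun I db hI => encodesMatrix_two.2 fun d d' => ?_⟩
      · rw [hh, ← hx, ← hy']; rfl
      · have := Q.eval_comp_head db fun z => if z = x then d else d'
        rw [h5 ⟨(I, db), hI⟩] at this
        simp only [if_true, if_neg (Ne.symm hxy), hh] at this
        refine Eq.trans ?_ this
        congr 1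
        funext i
        fin_cases i
        · simp
        · simp [Ne.symm hxy]
    · obtain ⟨x, -, hx⟩ := hτ α ∅
      obtain ⟨Q, hh, h1, h2, h3, h4, h5⟩ := fin (hM.diag x hx hx) (by simp) le_rfl
        (head := ![x, x]) (by ext z; simp [eq_comm, Fin.exists_fin_two])
      refine ⟨Q, ⟨h1, h2, h3⟩, ⟨τ, h4, ?_⟩, fun I db hI => encodesMatrix_two.2 fun d d' => ?_⟩
      · rw [hh, ← hx]; rfl
      · by_cases hd : d = d'
        · subst hd
          have := Q.eval_comp_head db fun _ => d
          rw [h5 ⟨(I, db), hI⟩] at this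
          refine Eq.trans ?_ this
          congr 1
          funext i
          fin_cases i <;> rfl
        · rw [Q.eval_eq_zero db (i := 0) (j := 1) (by rw [hh]; rfl) (by simpa using hd)]
          exact (hp ⟨(I, db), hI⟩ d d' hd).symm
  · have vector : ∀ {γ : S.Size} {f : E.Inputs K → ℕ+ → K}, ((α, β) = (γ, S.one) ∨
        (α, β) = (S.one, γ)) → (∀ x, τ x = γ → IsTreeQuery E τ {x} fun P ν => f P (ν x)) →
        (∀ (P : E.Inputs K) (R : (Fin 1 → ℕ+) → K), (∀ d, R ![d] = f P d) →
          EncodesMatrix (e.eval P.1.1) 1 R) →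
        ∃ Q : Query σ 1, (Q.IsBinary ∧ Q.IsCQ ∧ Q.IsFreeConnex) ∧ E.QueryTyped (α, β) Q ∧
          E.Simulates K e Q := by
      intro γ f hγ hf hR
      obtain ⟨x, -, hx⟩ := hτ γ ∅
      obtain ⟨Q, hh, h1, h2, h3, h4, h5⟩ := fin (hf x hx) (by simp) one_le_two
        (head := ![x]) (by simp)
      refine ⟨Q, ⟨h1, h2, h3⟩, ⟨τ, h4, ?_⟩, fun I db hI => hR ⟨(I, db), hI⟩ _ fun d => ?_⟩
      · rw [hh]
        subst hx
        exact hγ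
      · have := Q.eval_comp_head db fun _ => d
        rw [h5 ⟨(I, db), hI⟩] at this
        refine Eq.trans ?_ this
        congr 1
        funext i
        rw [Subsingleton.elim i 0]
        rfl
    rcases hk with hk | hk
    · obtain rfl : α = S.one := hk
      exact vector (Or.inr rfl) (fun x hx => hM.row hτ hx)
        fun P R hR => (encodesMatrix_row (one P)).2 hR
    · obtain rfl : β = S.one := hk
      exact vector (Or.inl rfl) (fun x hx => hM.col hτ hx)
        fun P R hR => (encodesMatrix_col (one P)).2 hR
  · obtain ⟨rfl, rfl⟩ := Prod.mk.inj hk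
    obtain ⟨x, -, hx⟩ := hτ S.one ∅
    -- `QueryTree.headless` needs a head variable, so it is applied before `x` is quantified
    obtain ⟨L, b, -, hL⟩ := hM.col hτ hx ∅
    have hL' := hL.sumVar (Finset.mem_singleton_self x) (by simp)
    rw [show ({x} : Finset ℕ).erase x = ∅ by simp] at hL'
    obtain ⟨Q, hh, h1, h2, h3, h4, h5⟩ := hL'.exists_query
      (hL.headless (by simp) (by simp) ∅) (k := 0) (by omega) (head := ![]) (by simp)
    refine ⟨Q, ⟨h1, h2, h3⟩, ⟨τ, h4, rfl⟩, fun I db hI =>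
      (encodesMatrix_zero (one ⟨(I, db), hI⟩) (one ⟨(I, db), hI⟩)).2 ?_⟩
    have := Q.eval_comp_head db fun _ => 1
    rw [h5 ⟨(I, db), hI⟩, IsMatrixQuery.sumVar_one hx, Function.update_self] at this
    refine Eq.trans ?_ this
    congr 1
    exact Subsingleton.elim _ _

end MatrixQuery

theorem mainTheorem5 (K : Type w) [CommSemiring K] [Nontrivial K] :
    EquallyExpressive.{u, v, w} K
      (fun _ _ _ e => e.IsFC)
      (fun _ _ Q => Q.IsBinary ∧ Q.IsCQ ∧ Q.IsFreeConnex) :=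
  ⟨fun _ _ _ _ _ _ _ he hk => exists_query_of_expr he hk,
    fun _ _ _ _ _ _ _ hQ _ _ ht => exists_expr_of_query hQ.1.1 hQ.2.1 hQ.2.2.2 ht⟩
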